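/- All functions are measurable functions $f\colon(0,1)\to[-\infty,\infty]$, where $(0,1)$ carries Lebesgue measure. Write $f_*(s)=|\{x:|f(x)|>s\}|$ and $f^*(t)=\inf\{s\ge0: f_*(s)\le t\}$. Each space below is the set of all $f$ at which the given functional is finite. A *Young function* is a left-continuous convex function $A\colon[0,\infty]\to[0,\infty]$ with $A(0)=0$ that is neither identically $0$ nor identically $\infty$ on $(0,\infty]$; it is *finite-valued* if $A(t)<\infty$ for all $t<\infty$. Put $A^{-1}(t)=\sup\{\tau\ge 0:A(\tau)\le t\}$, with the conventions $1/0=\infty$ and $1/\infty=0$ below. We write $A\in\Delta_2$ near infinity if there are $C,t_0\in(0,\infty)$ with $A(2t)\le CA(t)$ for all $t\ge t_0$, and $A\in\nabla_2$ near infinity if there are $c,t_0\in(0,\infty)$ with $2cA(t)\le A(ct)$ for all $t\ge t_0$. The functionals are the usual one for the Lebesgue space $L^q$ and $$\|f\|_{L^A}=\inf\Bigl\{\lambda>0:\int_0^1A(|f|/\lambda)\le1\Bigr\},\qquad \|f\|_{\Lambda^A}=\int_0^\infty\frac{ds}{A^{-1}(1/f_*(s))},$$ $$\|f\|_{L^{p,q}}=\Bigl(\int_0^\infty[t^{1/p}f^*(t)]^q\frac{dt}{t}\Bigr)^{1/q}\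 (q<\infty),\qquad \|f\|_{L^{p,\infty}}=\sup_{t>0}t^{1/p}f^*(t),$$ $$\|f\|_{\Lambda^q_w}=\Bigl(\int_0^1f^*(t)^q\,w(t)\,dt\Bigr)^{1/q}\ (q<\infty).$$ For spaces $X,Y$ of this kind, $X\hookrightarrow Y$ means that $\|f\|_Y\le C\|f\|_X$ for all $f\in X$ with some constant $C$. $X$ is *almost compactly embedded* into $Y$ if $\lim_{n\to\infty}\sup_{\|f\|_X\le1}\|f\chi_{E_n}\|_Y=0$ for every sequence of measurable sets $E_n$ with $\chi_{E_n}\to0$ a.e. The space $X$ is *sub-diagonal* if $X=\bigcup\{L^A: A$ a Young function, $L^A\hookrightarrow X\}$, and *uniformly sub-diagonal* if $X=\bigcup\{L^A: A$ a Young function, $L^A$ almost compactly embedded into $X\}$. **Theorem.** Let $E$ be a Young function, $p\in(1,\infty)$, $q\in[1,\infty]$, and let $w\colon(0,1)\to(0,\infty)$ be non-increasing and integrable. 1. $L^q$ is sub-diagonal. It is uniformly sub-diagonal if and only if $q<\infty$. 2. $L^E$ is sub-diagonal. It is uniformly sub-diagonal if and only if $E$ is finite-valued and $E\in\Delta_2$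 near infinity. 3. $L^{p,q}$ is sub-diagonal if and only if it is uniformly sub-diagonal, which is the case if and only if $q\le p$. 4. $\Lambda^E$ is sub-diagonal. If $E$ is finite-valued and $E\in\nabla_2$ near infinity, then $\Lambda^E$ is uniformly sub-diagonal. 5. Let $q<\infty$. Then $\Lambda^q_w$ is sub-diagonal. It is uniformly sub-diagonal if there is $c>0$ such that $2w(ct)\le w(t)$ whenever $t\in(0,1)$ and $ct\in(0,1)$. -/

import Mathlib

open MeasureTheory Set Filter Topology
open scoped ENNReal NNReal

/-- Young functions `A : [0,∞] → [0,∞]`: left-continuous, convex, vanishing at `0`, and neither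
identically zero nor identically infinite on `(0,∞]`. -/
structure IsYoung (A : ℝ≥0∞ → ℝ≥0∞) : Prop where
  map_zero : A 0 = 0
  leftContinuous : ∀ t, ContinuousWithinAt A (Iic t) t
  ne_zero : ∃ t, 0 < t ∧ A t ≠ 0
  ne_top : ∃ t, 0 < t ∧ A t ≠ ∞
  convex : ConvexOn ℝ≥0 univ A

/-- `A` is finite-valued (on `[0,∞)`). -/
def IsFiniteValued (A : ℝ≥0∞ → ℝ≥0∞) : Prop :=
  ∀ t : ℝ≥0, A t < ∞

/-- `A(2t) ≤ C A(t)` near infinity, for some constant `0 < C < ∞`. -/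
def DeltaTwoNearInfinity (A : ℝ≥0∞ → ℝ≥0∞) : Prop :=
  ∃ C : ℝ≥0, 0 < C ∧ ∃ t₀ : ℝ≥0, ∀ t : ℝ≥0, t₀ ≤ t → A (2 * t) ≤ C * A t

/-- `2c A(t) ≤ A(ct)` near infinity, for some constant `0 < c < ∞`. -/
def NablaTwoNearInfinity (A : ℝ≥0∞ → ℝ≥0∞) : Prop :=
  ∃ c : ℝ≥0, 0 < c ∧ ∃ t₀ : ℝ≥0, ∀ t : ℝ≥0, t₀ ≤ t → 2 * c * A t ≤ A (c * t)

/-- The right-continuous inverse `A⁻¹(t) = sup {τ ≥ 0 : A(τ) ≤ t}`. -/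
noncomputable def rightInv (A : ℝ≥0∞ → ℝ≥0∞) (t : ℝ≥0∞) : ℝ≥0∞ :=
  sSup {τ | A τ ≤ t}

/-- The correlative function `F_#(t) = 1 / F(1/t)`. -/
noncomputable def correlative (F : ℝ≥0∞ → ℝ≥0∞) (t : ℝ≥0∞) : ℝ≥0∞ :=
  (F t⁻¹)⁻¹

section FunctionSpaces

variable {α : Type*} [MeasurableSpace α]

/-- The distribution function `f_*` of an extended-real-valued function. -/
noncomputable def distrib (μ : Measure α) (f : α → EReal) (s : ℝ≥0∞) : ℝ≥0∞ :=
  μ {x | s < (f x).abs}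

/-- The non-increasing rearrangement `f^*`. -/
noncomputable def rearr (μ : Measure α) (f : α → EReal) (t : ℝ≥0∞) : ℝ≥0∞ :=
  sInf {s | distrib μ f s ≤ t}

/-- The space of all measurable `f` with `N f < ∞`, where `N` is a functional on
extended-real-valued functions. -/
def spaceOf (N : (α → EReal) → ℝ≥0∞) : Set (α → EReal) :=
  {f | Measurable f ∧ N f < ∞}

/-- The Lebesgue functional `‖f‖_{L^q}`. -/
noncomputable def lebesgueNorm (μ : Measure α) (q : ℝ≥0∞) (f : α → EReal) : ℝ≥0∞ :=
  eLpNorm (fun x => (f x).abs) q μ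

/-- The Orlicz semimodular `∫ A(|f|/s)`. -/
noncomputable def orliczModular (μ : Measure α) (A : ℝ≥0∞ → ℝ≥0∞) (f : α → EReal)
    (s : ℝ≥0∞) : ℝ≥0∞ :=
  ∫⁻ x, A ((f x).abs / s) ∂μ

/-- The Luxemburg norm `‖f‖_{L^A} = inf {0 < s < ∞ : ∫ A(|f|/s) ≤ 1}` (and `inf ∅ = ∞`). -/
noncomputable def orliczNorm (μ : Measure α) (A : ℝ≥0∞ → ℝ≥0∞) (f : α → EReal) : ℝ≥0∞ :=
  sInf {s | 0 < s ∧ s < ∞ ∧ orliczModular μ A f s ≤ 1}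

open Classical in
/-- The Lorentz functional `‖f‖_{p,q}`. (For `p = ∞` the exponent `1/p` evaluates to `0`.) -/
noncomputable def lorentzNorm (μ : Measure α) (p q : ℝ≥0∞) (f : α → EReal) : ℝ≥0∞ :=
  if q = ∞ then
    ⨆ t ∈ Ioi (0 : ℝ), ENNReal.ofReal t ^ (1 / p.toReal) * rearr μ f (ENNReal.ofReal t)
  else
    (∫⁻ t in Ioi (0 : ℝ),
      (ENNReal.ofReal t ^ (1 / p.toReal) * rearr μ f (ENNReal.ofReal t)) ^ q.toReal
        / ENNReal.ofReal t) ^ (1 / q.toReal)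

/-- The Lorentz endpoint functional `‖f‖_{Λ^A} = ∫₀^∞ (A⁻¹)_#(f_*(s)) ds`. -/
noncomputable def lorentzEndpointNorm (μ : Measure α) (A : ℝ≥0∞ → ℝ≥0∞) (f : α → EReal) :
    ℝ≥0∞ :=
  ∫⁻ s in Ioi (0 : ℝ), correlative (rightInv A) (distrib μ f (ENNReal.ofReal s))

/-- The classical Lorentz functional `(∫₀^∞ f^*(t)^q w(t) dt)^{1/q}`. -/
noncomputable def classicalLorentzNorm (μ : Measure α) (q : ℝ) (w : ℝ → ℝ) (f : α → EReal) :
    ℝ≥0∞ :=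
  (∫⁻ t in Ioi (0 : ℝ), rearr μ f (ENNReal.ofReal t) ^ q * ENNReal.ofReal (w t)) ^ (1 / q)

/-- Continuous embedding of the space of `N` into the space of `M`. -/
def Embeds (N M : (α → EReal) → ℝ≥0∞) : Prop :=
  ∃ C : ℝ≥0, ∀ f ∈ spaceOf N, M f ≤ C * N f

/-- Almost compact embedding of the space of `N` into the space of `M`:
`sup_{‖f‖_N ≤ 1} ‖f χ_{Eₙ}‖_M → 0` whenever `χ_{Eₙ} → 0` almost everywhere. -/
def AlmostCompactlyEmbeds (μ : Measure α) (N M : (α → EReal) → ℝ≥0∞) : Prop :=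
  ∀ E : ℕ → Set α, (∀ n, MeasurableSet (E n)) →
    (∀ᵐ x ∂μ, Tendsto (fun n => (E n).indicator (fun _ => (1 : ℝ)) x) atTop (𝓝 0)) →
    Tendsto (fun n => ⨆ f ∈ {f ∈ spaceOf N | N f ≤ 1}, M ((E n).indicator f)) atTop (𝓝 0)

/-- The space of `M` is the union of the Orlicz spaces embedded into it. -/
def IsSubDiagonal (μ : Measure α) (M : (α → EReal) → ℝ≥0∞) : Prop :=
  spaceOf M = ⋃ A ∈ {A | IsYoung A ∧ Embeds (orliczNorm μ A) M}, spaceOf (orliczNorm μ A)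

/-- The space of `M` is the union of the Orlicz spaces almost compactly embedded into it. -/
def IsUniformlySubDiagonal (μ : Measure α) (M : (α → EReal) → ℝ≥0∞) : Prop :=
  spaceOf M =
    ⋃ A ∈ {A | IsYoung A ∧ AlmostCompactlyEmbeds μ (orliczNorm μ A) M}, spaceOf (orliczNorm μ A)

end FunctionSpaces

/-- Lebesgue measure on `(0,1)`. -/
noncomputable def unitMeasure : Measure ℝ :=
  volume.restrict (Ioo (0 : ℝ) 1)

/-! Orlicz spaces are trivially sub-diagonal, and `L^q` is one of them. The remaining positive
results come from one functional, `layerNorm`: (∫ φ(|{|f|^q > s}|) ds)^{1/q} with φ quasiconcave.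
For `Λ^E` the exponent is 1 and φ is the correlative of E⁻¹; for `Λ^q_w` φ is the primitive of w;
`L^{p,q}` with q < p is the case w(t) = t^{q/p-1}, while `L^{p,p}` = `L^p`.

Given f, let d(s) be the distribution function of F = max(|f|^q, 1). As φ(d)/d is non-increasing in
d, the function a(s) = φ(d(s))/d(s) is non-decreasing, so its primitive A is a Young function. The
layer-cake formula gives ∫ A(F) ≤ ∫ φ(d(s)) ds < ∞, so f lies in the Orlicz space of t ↦ A(t^q).
Conversely φ(u) ≤ φ(d) + (φ(d)/d) u; with u the distribution function of g and d = d(s), integration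
yields the embedding (`setLIntegral_comp_distribution_le`). If 2φ(Kt) ≤ Kφ(t) near 0, iteration
improves this to φ(u) ≤ (K/2)^j φ(d) + 2^{-j} (φ(d)/d) u for small d, that is, at high levels s. The
second term is then small for large j, the first is a convergent tail, and the low levels are
controlled by the smallness of the sets. This is almost compactness.

For `L^E` with Δ₂, a de la Vallée Poussin function Φ keeps Φ(E(|f|/r)) integrable while dominating
every multiple of E, and Δ₂ absorbs the rescaling. Conversely, uniform sub-diagonality forces tails
of each f in `L^E` to have small norm; constants and step functions violate this when E takes the
value ∞ or Δ₂ fails.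

For p < q, an Orlicz space inside `L^{p,q}` lies in weak `L^p`, which forces t^p ≲ A(t)
(`rpow_le_of_subset`) and hence places it in `L^p`. But `L^{p,q}` contains a function outside `L^p`.
-/

/-! ### Elementary properties of Young functions -/

namespace IsYoung

variable {A B : ℝ≥0∞ → ℝ≥0∞}

theorem map_mul_le (hA : IsYoung A) {a : ℝ≥0∞} (ha : a ≤ 1) (t : ℝ≥0∞) :
    A (a * t) ≤ a * A t := by
  lift a to ℝ≥0 using ne_top_of_le_ne_top ENNReal.one_ne_top ha
  have ha' : a ≤ 1 := by exact_mod_cast ha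
  have := hA.convex.2 (mem_univ t) (mem_univ 0) (zero_le : 0 ≤ a) (zero_le : 0 ≤ 1 - a)
    (add_tsub_cancel_of_le ha')
  simpa [hA.map_zero, ENNReal.smul_def] using this

theorem monotoneOn_ne_top (hA : IsYoung A) {s t : ℝ≥0∞} (hst : s ≤ t) (ht : t ≠ ∞) :
    A s ≤ A t := by
  rcases eq_or_ne t 0 with rfl | h0
  · rw [le_antisymm hst zero_le]
  · have h1 : s / t ≤ 1 := ENNReal.div_le_of_le_mul (by simpa using hst)
    calc A s = A (s / t * t) := by rw [ENNReal.div_mul_cancel h0 ht]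
      _ ≤ s / t * A t := hA.map_mul_le h1 t
      _ ≤ 1 * A t := by gcongr
      _ = A t := one_mul _

/-- Half of ∞ is ∞, so convexity gives A(∞) ≤ A(∞)/2, leaving only 0 and ∞. The value 0 is excluded
by left-continuity at ∞, since A is non-decreasing on finite arguments and not identically 0. -/
theorem map_top (hA : IsYoung A) : A ∞ = ∞ := by
  have hhalf : A ∞ ≤ 2⁻¹ * A ∞ := by
    simpa [ENNReal.mul_top] using
      hA.map_mul_le (a := 2⁻¹) (by simp) ∞
  by_contra htop
  have h0 : A ∞ = 0 := by
    by_contra h0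
    have : 2⁻¹ * A ∞ < 1 * A ∞ := by
      apply (ENNReal.mul_lt_mul_iff_left h0 htop).2
      simp
    rw [one_mul] at this
    exact absurd hhalf this.not_ge
  obtain ⟨t, ht, hAt⟩ := hA.ne_zero
  have htt : t ≠ ∞ := fun h => hAt (h ▸ h0)
  have hc := hA.leftContinuous ∞
  have hlim : Tendsto (fun n : ℕ => A n) atTop (𝓝 (A ∞)) :=
    hc.tendsto.comp (tendsto_nhdsWithin_iff.2 ⟨ENNReal.tendsto_nat_nhds_top, by simp⟩)
  obtain ⟨N, hN⟩ := ENNReal.exists_nat_gt htt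
  have : A t ≤ A ∞ := ge_of_tendsto hlim <| eventually_atTop.2 ⟨N, fun n hn =>
    hA.monotoneOn_ne_top (hN.le.trans (by exact_mod_cast hn)) (by simp)⟩
  exact hAt (le_antisymm (h0 ▸ this) zero_le)

theorem monotone (hA : IsYoung A) : Monotone A := by
  intro s t hst
  rcases eq_or_ne t ∞ with rfl | ht
  · rw [hA.map_top]; exact le_top
  · exact hA.monotoneOn_ne_top hst ht

theorem measurable (hA : IsYoung A) : Measurable A := hA.monotone.measurable

theorem exists_lt (hA : IsYoung A) {ε : ℝ≥0∞} (hε : ε ≠ 0) :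
    ∃ t, 0 < t ∧ t ≠ ∞ ∧ A t < ε := by
  obtain ⟨t, ht, hAt⟩ := hA.ne_top
  have htt : t ≠ ∞ := fun h => hAt (h ▸ hA.map_top)
  have hl : Tendsto (fun n : ℕ => (n : ℝ≥0∞)⁻¹ * A t) atTop (𝓝 (0 * A t)) :=
    ENNReal.Tendsto.mul_const ENNReal.tendsto_inv_nat_nhds_zero (Or.inr hAt)
  rw [zero_mul] at hl
  obtain ⟨n, hn, hn1⟩ := ((hl.eventually_lt_const (pos_iff_ne_zero.2 hε)).and
    (eventually_ge_atTop 1)).exists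
  refine ⟨(n : ℝ≥0∞)⁻¹ * t, ?_, ?_, (hA.map_mul_le ?_ t).trans_lt hn⟩
  · exact ENNReal.mul_pos (by simp) ht.ne'
  · exact ENNReal.mul_ne_top (by simp; omega) htt
  · exact ENNReal.inv_le_one.2 (by exact_mod_cast hn1)

theorem exists_gt (hA : IsYoung A) {K : ℝ≥0∞} (hK : K ≠ ∞) :
    ∃ t : ℝ≥0, 0 < t ∧ K < A t := by
  have hc := (hA.leftContinuous ∞).tendsto
  rw [hA.map_top] at hc
  have hlim : Tendsto (fun n : ℕ => A n) atTop (𝓝 ∞) :=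
    hc.comp (tendsto_nhdsWithin_iff.2 ⟨ENNReal.tendsto_nat_nhds_top, by simp⟩)
  obtain ⟨n, hn, hn1⟩ := ((hlim.eventually_const_lt (lt_top_iff_ne_top.2 hK)).and
    (eventually_ge_atTop 1)).exists
  exact ⟨n, by exact_mod_cast hn1, by simpa using hn⟩

theorem comp (hB : IsYoung B) (hA : IsYoung A) : IsYoung (fun t => B (A t)) where
  map_zero := by rw [hA.map_zero, hB.map_zero]
  leftContinuous t := (hB.leftContinuous (A t)).comp (hA.leftContinuous t)
    fun _ hs => hA.monotone hs
  ne_zero := ⟨∞, by simp, by simp [hA.map_top, hB.map_top]⟩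
  ne_top := by
    obtain ⟨s, hs, -, hBs⟩ := hB.exists_lt one_ne_zero
    obtain ⟨t, ht, -, hAt⟩ := hA.exists_lt hs.ne'
    exact ⟨t, ht, ((hB.monotone hAt.le).trans_lt (hBs.trans ENNReal.one_lt_top)).ne⟩
  convex := ⟨convex_univ, fun s _ t _ a b ha hb hab =>
    (hB.monotone (hA.convex.2 (mem_univ s) (mem_univ t) ha hb hab)).trans
      (hB.convex.2 (mem_univ _) (mem_univ _) ha hb hab)⟩

theorem rpow {q : ℝ} (hq : 1 ≤ q) : IsYoung (fun t => t ^ q) where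
  map_zero := ENNReal.zero_rpow_of_pos (by linarith)
  leftContinuous t := (ENNReal.continuous_rpow_const (y := q)).continuousWithinAt
  ne_zero := ⟨1, by simp, by simp⟩
  ne_top := ⟨1, by simp, by simp⟩
  convex := ⟨convex_univ, fun s _ t _ a b _ _ hab => by
    simpa [ENNReal.smul_def] using ENNReal.rpow_arith_mean_le_arith_mean2_rpow a b s t
      (by exact_mod_cast hab) hq⟩

end IsYoung

/-! ### Young functions as primitives of non-decreasing densities -/

theorem Monotone.continuousWithinAt_Iic_of_forall_lt {α β : Type*} [LinearOrder α]
    [TopologicalSpace α] [OrderTopology α] [LinearOrder β] [TopologicalSpace β] [OrderTopology β]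
    {A : α → β} (hA : Monotone A) {t : α} (h : ∀ l < A t, ∃ s < t, l < A s) :
    ContinuousWithinAt A (Iic t) t := by
  refine tendsto_order.2 ⟨fun l hl => ?_, fun u hu => ?_⟩
  · obtain ⟨s, hst, hls⟩ := h l hl
    filter_upwards [nhdsWithin_le_nhds (Ioi_mem_nhds hst)] with x hx
    exact hls.trans_le (hA (le_of_lt hx))
  · filter_upwards [self_mem_nhdsWithin] with x hx
    exact (hA hx).trans_lt hu

/-- The function `t ↦ ∫₀ᵗ a(s) ds`. -/
noncomputable def primitive (a : ℝ → ℝ≥0∞) (t : ℝ≥0∞) : ℝ≥0∞ :=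
  ∫⁻ s in Ioi (0 : ℝ), {s | ENNReal.ofReal s < t}.indicator a s

section Primitive

variable {a : ℝ → ℝ≥0∞}

theorem primitive_zero : primitive a 0 = 0 := by simp [primitive]

theorem primitive_mono : Monotone (primitive a) := fun _ _ hst =>
  lintegral_mono fun _ => indicator_le_indicator_of_subset (fun _ hs => lt_of_lt_of_le hs hst)
    (fun _ => zero_le) _

theorem measurableSet_ofReal_lt (t : ℝ≥0∞) : MeasurableSet {s : ℝ | ENNReal.ofReal s < t} :=
  measurableSet_lt ENNReal.measurable_ofReal measurable_const

theorem volume_ofReal_lt (t : ℝ≥0∞) :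
    volume.restrict (Ioi (0 : ℝ)) {s | ENNReal.ofReal s < t} = t := by
  rw [Measure.restrict_apply (measurableSet_ofReal_lt t)]
  rcases eq_or_ne t ∞ with rfl | ht
  · simp
  · have : {s | ENNReal.ofReal s < t} ∩ Ioi (0 : ℝ) = Ioo 0 t.toReal := by
      ext s
      simp only [mem_inter_iff, mem_ofPred_eq, mem_Ioi, mem_Ioo]
      rw [and_comm, and_congr_right_iff]
      intro hs
      rw [ENNReal.ofReal_lt_iff_lt_toReal hs.le ht]
    rw [this]
    simp [ENNReal.ofReal_toReal ht]

theorem primitive_const (c t : ℝ≥0∞) : primitive (fun _ => c) t = c * t := by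
  rw [primitive, lintegral_indicator_const (measurableSet_ofReal_lt t), volume_ofReal_lt]

theorem lt_primitive_of_lt (ha : Measurable a) {t l : ℝ≥0∞} (hl : l < primitive a t) :
    ∃ s < t, l < primitive a s := by
  have ht : 0 < t := by
    rcases eq_or_ne t 0 with rfl | h
    · simp [primitive_zero] at hl
    · exact pos_iff_ne_zero.2 h
  obtain ⟨u, hu, hut, hlim⟩ := exists_seq_strictMono_tendsto' ht
  have key : Tendsto (fun n => primitive a (u n)) atTop (𝓝 (primitive a t)) := by
    refine lintegral_tendsto_of_tendsto_of_monotone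
      (fun n => (ha.indicator (measurableSet_ofReal_lt _)).aemeasurable) ?_ ?_
    · refine ae_of_all _ fun s m n hmn => ?_
      exact indicator_le_indicator_of_subset (fun r hr => lt_of_lt_of_le hr (hu.monotone hmn))
        (fun _ => zero_le) _
    · refine ae_of_all _ fun s => ?_
      by_cases hs : ENNReal.ofReal s < t
      · refine tendsto_const_nhds.congr' ?_
        filter_upwards [hlim.eventually_const_lt hs] with n hn
        rw [indicator_of_mem (by exact hs), indicator_of_mem (by exact hn)]
      · have h1 : ∀ n, ¬ ENNReal.ofReal s < u n := fun n h => hs (h.trans (hut n).2)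
        simp [indicator, hs, h1]
  obtain ⟨n, hn⟩ := (key.eventually_const_lt hl).exists
  exact ⟨u n, (hut n).2, hn⟩

/-- The supporting line at z with slope a(z), written without subtraction: between y and z the
density lies on the correct side of a(z). -/
theorem primitive_add_le (ha : Monotone a) (y : ℝ≥0∞) (z : ℝ≥0) :
    primitive a z + a z * y ≤ primitive a y + a z * z := by
  have hm := ha.measurable
  rw [← primitive_const, ← primitive_const (a z) z]
  unfold primitive
  rw [← lintegral_add_left (hm.indicator (measurableSet_ofReal_lt _)),
    ← lintegral_add_left (hm.indicator (measurableSet_ofReal_lt _))]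
  refine setLIntegral_mono' measurableSet_Ioi fun s hs => ?_
  have hs0 : 0 ≤ s := le_of_lt hs
  by_cases h1 : ENNReal.ofReal s < z <;> by_cases h2 : ENNReal.ofReal s < y <;>
    simp only [indicator, mem_ofPred_eq, h1, h2, if_true, if_false, zero_add, add_zero, le_refl]
  · apply ha
    rw [ENNReal.ofReal_lt_iff_lt_toReal hs0 (by simp)] at h1
    exact h1.le
  · apply ha
    rw [ENNReal.ofReal_lt_iff_lt_toReal hs0 (by simp), not_lt] at h1
    exact h1

theorem primitive_iSup {f : ℕ → ℝ → ℝ≥0∞} (hf : ∀ n, Measurable (f n)) (hmono : Monotone f)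
    (t : ℝ≥0∞) : primitive (fun s => ⨆ n, f n s) t = ⨆ n, primitive (f n) t := by
  unfold primitive
  rw [← lintegral_iSup (fun n => (hf n).indicator (measurableSet_ofReal_lt _))]
  · refine lintegral_congr fun s => ?_
    by_cases h : ENNReal.ofReal s < t <;> simp [indicator, h]
  · intro m n hmn s
    by_cases h : ENNReal.ofReal s < t <;> simp [indicator, h, hmono hmn s]

theorem primitive_convex_of_ne_top (ha : Monotone a) (hfin : ∀ s, a s ≠ ∞) {x y : ℝ≥0∞}
    {θ η : ℝ≥0} (hθη : θ + η = 1) {z : ℝ≥0} (hz : θ * x + η * y = z) :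
    primitive a z ≤ θ * primitive a x + η * primitive a y := by
  have hc : a z * z ≠ ∞ := ENNReal.mul_ne_top (hfin _) (by simp)
  have h1 : (θ : ℝ≥0∞) + η = 1 := by exact_mod_cast hθη
  refine (ENNReal.add_le_add_iff_right hc).1 ?_
  calc primitive a z + a z * z
      = (θ + η) * primitive a z + a z * (θ * x + η * y) := by rw [h1, hz, one_mul]
    _ = θ * (primitive a z + a z * x) + η * (primitive a z + a z * y) := by ring
    _ ≤ θ * (primitive a x + a z * z) + η * (primitive a y + a z * z) := by
        exact add_le_add (mul_le_mul_right (primitive_add_le ha _ z) _)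
          (mul_le_mul_right (primitive_add_le ha _ z) _)
    _ = θ * primitive a x + η * primitive a y + (θ + η) * (a z * z) := by ring
    _ = _ := by rw [h1, one_mul]

/-- The supporting-line argument cancels a(z)·z and so needs a finite density; the general case
follows by truncating at n and monotone convergence. -/
theorem primitive_convex (ha : Monotone a) (htop : primitive a ∞ = ∞) :
    ConvexOn ℝ≥0 univ (primitive a) := by
  refine ⟨convex_univ, fun x _ y _ θ η _ _ hθη => ?_⟩
  simp only [ENNReal.smul_def, smul_eq_mul]
  by_cases hz : (θ : ℝ≥0∞) * x + η * y = ∞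
  · rcases ENNReal.add_eq_top.1 hz with h | h
    · obtain ⟨h0, rfl⟩ : (θ : ℝ≥0∞) ≠ 0 ∧ x = ∞ := by
        simpa [ENNReal.mul_eq_top] using h
      simp [htop, ENNReal.mul_top h0]
    · obtain ⟨h0, rfl⟩ : (η : ℝ≥0∞) ≠ 0 ∧ y = ∞ := by
        simpa [ENNReal.mul_eq_top] using h
      simp [htop, ENNReal.mul_top h0]
  · obtain ⟨z, hz'⟩ := (⟨_, ENNReal.coe_toNNReal hz⟩ : ∃ z : ℝ≥0, (z : ℝ≥0∞) = _)
    rw [← hz']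
    have hsup : a = fun s => ⨆ n : ℕ, min (a s) n := by
      ext s
      rw [← inf_iSup_eq, ENNReal.iSup_natCast, inf_top_eq]
    have hmono : Monotone fun (n : ℕ) (s : ℝ) => min (a s) (n : ℝ≥0∞) := fun m n hmn s =>
      min_le_min_left _ (by exact_mod_cast hmn)
    have hmono' : ∀ n : ℕ, Monotone fun s => min (a s) (n : ℝ≥0∞) := fun n s t hst =>
      min_le_min_right _ (ha hst)
    have hle : ∀ (n : ℕ) t, primitive (fun s => min (a s) n) t ≤ primitive a t := fun n t =>
      lintegral_mono fun s => indicator_le_indicator (min_le_left _ _)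
    conv_lhs => rw [hsup]
    rw [primitive_iSup (fun n => (hmono' n).measurable) hmono]
    refine iSup_le fun n => (primitive_convex_of_ne_top (hmono' n) (fun s => ?_) hθη hz'.symm).trans
      (by gcongr <;> exact hle n _)
    exact ne_top_of_le_ne_top (ENNReal.natCast_ne_top n) (min_le_right _ _)

theorem IsYoung.primitive (ha : Monotone a) {κ : ℝ≥0∞} (hκ : κ ≠ 0) (hκa : ∀ s, κ ≤ a s)
    {r : ℝ} (hr : 0 < r) (har : a r ≠ ∞) : IsYoung (primitive a) := by
  have htop : _root_.primitive a ∞ = ∞ := by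
    refine top_le_iff.1 ?_
    calc ∞ = κ * ∞ := (ENNReal.mul_top hκ).symm
      _ = _root_.primitive (fun _ => κ) ∞ := (primitive_const _ _).symm
      _ ≤ _ := lintegral_mono fun s => indicator_le_indicator (hκa s)
  refine ⟨primitive_zero, fun t => ?_, ⟨∞, by simp, by simp [htop]⟩,
    ⟨ENNReal.ofReal r, by simpa, ?_⟩, primitive_convex ha htop⟩
  · exact primitive_mono.continuousWithinAt_Iic_of_forall_lt
      fun l hl => lt_primitive_of_lt ha.measurable hl
  · refine ne_top_of_le_ne_top (ENNReal.mul_ne_top har (ENNReal.ofReal_ne_top (r := r))) ?_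
    rw [← primitive_const (a r)]
    refine setLIntegral_mono' measurableSet_Ioi fun s hs => ?_
    by_cases h : ENNReal.ofReal s < ENNReal.ofReal r
    · simpa [indicator, h] using ha ((ENNReal.ofReal_lt_ofReal_iff hr).1 h).le
    · simp [indicator, h]

/-- Layer-cake formula, by Tonelli. -/
theorem lintegral_primitive {α : Type*} [MeasurableSpace α] {μ : Measure α} [SFinite μ]
    (ha : Measurable a) {g : α → ℝ≥0∞} (hg : Measurable g) :
    ∫⁻ x, primitive a (g x) ∂μ =
      ∫⁻ s in Ioi (0 : ℝ), a s * μ {x | ENNReal.ofReal s < g x} := by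
  unfold primitive
  rw [lintegral_lintegral_swap]
  · refine lintegral_congr fun s => ?_
    rw [← lintegral_indicator_const (measurableSet_lt measurable_const hg)]
    rfl
  · exact (Measurable.indicator (ha.comp measurable_snd) (measurableSet_lt
      (ENNReal.measurable_ofReal.comp measurable_snd) (hg.comp measurable_fst))).aemeasurable

end Primitive

/-! ### The Young function of `L^∞`; absolute values of extended reals -/

/-- The Young function of `L^∞`. -/
noncomputable def linftyYoung (t : ℝ≥0∞) : ℝ≥0∞ := if t ≤ 1 then 0 else ∞

theorem isYoung_linftyYoung : IsYoung linftyYoung where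
  map_zero := by simp [linftyYoung]
  leftContinuous t := by
    refine Monotone.continuousWithinAt_Iic_of_forall_lt (fun s t hst => ?_) fun l hl => ?_
    · unfold linftyYoung
      split_ifs with h1 h2
      · exact le_rfl
      · exact zero_le
      · exact absurd (hst.trans ‹_›) h1
      · exact le_rfl
    · unfold linftyYoung at *
      split_ifs at hl with h
      · simp at hl
      · obtain ⟨s, hs1, hst⟩ := exists_between (not_le.1 h)
        exact ⟨s, hst, by simpa [hs1.not_ge] using hl⟩
  ne_zero := ⟨∞, by simp, by simp [linftyYoung]⟩
  ne_top := ⟨1, by simp, by simp [linftyYoung]⟩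
  convex := by
    refine ⟨convex_univ, fun x _ y _ a b _ _ hab => ?_⟩
    have hab' : (a : ℝ≥0∞) + b = 1 := by exact_mod_cast hab
    simp only [ENNReal.smul_def, smul_eq_mul]
    by_cases hx : (a : ℝ≥0∞) ≠ 0 ∧ ¬ x ≤ 1
    · simp [linftyYoung, hx.2, ENNReal.mul_top hx.1]
    by_cases hy : (b : ℝ≥0∞) ≠ 0 ∧ ¬ y ≤ 1
    · simp [linftyYoung, hy.2, ENNReal.mul_top hy.1]
    have h1 : (a : ℝ≥0∞) * x ≤ a * 1 := by
      by_cases h : (a : ℝ≥0∞) = 0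
      · simp [h]
      · gcongr
        by_contra h'
        exact hx ⟨h, h'⟩
    have h2 : (b : ℝ≥0∞) * y ≤ b * 1 := by
      by_cases h : (b : ℝ≥0∞) = 0
      · simp [h]
      · gcongr
        by_contra h'
        exact hy ⟨h, h'⟩
    have : (a : ℝ≥0∞) * x + b * y ≤ 1 := (add_le_add h1 h2).trans (by simp [hab'])
    simp [linftyYoung, this]

theorem measurable_ereal_abs : Measurable EReal.abs :=
  EReal.measurable_of_measurable_real (by
    simp only [EReal.abs_def]
    exact ENNReal.measurable_ofReal.comp continuous_abs.measurable)

theorem Measurable.ereal_abs {α : Type*} [MeasurableSpace α] {f : α → EReal}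
    (hf : Measurable f) : Measurable fun x => (f x).abs :=
  measurable_ereal_abs.comp hf

@[simp] theorem EReal.abs_coe_ennreal (x : ℝ≥0∞) : (x : EReal).abs = x := by
  induction x with
  | top => rfl
  | coe x => exact (EReal.abs_def x).trans (by simp)

/-! ### Orlicz norms and criteria for (uniform) sub-diagonality -/

section Framework

variable {α : Type*} [MeasurableSpace α] {μ : Measure α} {A : ℝ≥0∞ → ℝ≥0∞}
  {M M' : (α → EReal) → ℝ≥0∞} {f : α → EReal}

theorem orliczModular_anti (hA : IsYoung A) {r s : ℝ≥0∞} (hrs : r ≤ s) :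
    orliczModular μ A f s ≤ orliczModular μ A f r :=
  lintegral_mono fun _ => hA.monotone (ENNReal.div_le_div_left hrs _)

theorem orliczModular_le_one_of_lt (hA : IsYoung A) {r : ℝ≥0∞} (h : orliczNorm μ A f < r) :
    orliczModular μ A f r ≤ 1 := by
  obtain ⟨s, ⟨-, -, hs⟩, hsr⟩ := sInf_lt_iff.1 h
  exact (orliczModular_anti hA hsr.le).trans hs

theorem orliczNorm_le {s : ℝ≥0∞} (h0 : s ≠ 0) (htop : s ≠ ∞) (h : orliczModular μ A f s ≤ 1) :
    orliczNorm μ A f ≤ s :=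
  sInf_le ⟨pos_iff_ne_zero.2 h0, lt_top_iff_ne_top.2 htop, h⟩

/-- Convexity gives A(y/n) ≤ A(y)/n, so enlarging the scale by a factor n brings any finite modular
below 1. -/
theorem mem_spaceOf_orliczNorm (hA : IsYoung A) (hf : Measurable f) {s : ℝ≥0∞} (h0 : s ≠ 0)
    (htop : s ≠ ∞) (h : orliczModular μ A f s ≠ ∞) : f ∈ spaceOf (orliczNorm μ A) := by
  obtain ⟨n, hn⟩ := ENNReal.exists_nat_gt (ne_of_lt (max_lt h.lt_top ENNReal.one_lt_top))
  have hn1 : (1 : ℝ≥0∞) ≤ n := (le_max_right _ _).trans hn.le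
  have hn0 : (n : ℝ≥0∞) ≠ 0 := (zero_lt_one.trans_le hn1).ne'
  refine ⟨hf, (orliczNorm_le (s := n * s) (mul_ne_zero hn0 h0)
    (ENNReal.mul_ne_top (by simp) htop) ?_).trans_lt (ENNReal.mul_lt_top (by simp) htop.lt_top)⟩
  calc orliczModular μ A f (n * s)
      ≤ ∫⁻ x, (n : ℝ≥0∞)⁻¹ * A ((f x).abs / s) ∂μ := by
        refine lintegral_mono fun x => ?_
        rw [div_eq_mul_inv, ENNReal.mul_inv (Or.inl hn0) (Or.inl (by simp)), mul_left_comm,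
          ← div_eq_mul_inv]
        exact hA.map_mul_le (ENNReal.inv_le_one.2 hn1) _
    _ = (n : ℝ≥0∞)⁻¹ * orliczModular μ A f s := lintegral_const_mul' _ _ (ENNReal.inv_ne_top.2 hn0)
    _ ≤ (n : ℝ≥0∞)⁻¹ * n := by gcongr; exact (le_max_left _ _).trans hn.le
    _ ≤ 1 := ENNReal.inv_mul_le_one _

theorem embeds_orliczNorm {C : ℝ≥0}
    (h : ∀ f, Measurable f → ∀ s, s ≠ 0 → s ≠ ∞ → orliczModular μ A f s ≤ 1 → M f ≤ C * s) :
    Embeds (orliczNorm μ A) M := by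
  -- A nonzero constant is needed to move it inside the infimum, which may be over the empty set.
  refine ⟨max C 1, fun f hf => ?_⟩
  have hC : ((max C 1 : ℝ≥0) : ℝ≥0∞) ≠ 0 := by simp
  unfold orliczNorm
  rw [sInf_eq_iInf', ENNReal.mul_iInf_of_ne hC (by simp)]
  refine le_iInf fun ⟨s, hs0, hs, hs1⟩ => (h f hf.1 s hs0.ne' hs.ne hs1).trans ?_
  dsimp only
  gcongr
  exact le_max_left _ _

theorem isSubDiagonal_of
    (h : ∀ f ∈ spaceOf M, ∃ A, IsYoung A ∧ f ∈ spaceOf (orliczNorm μ A) ∧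
      Embeds (orliczNorm μ A) M) : IsSubDiagonal μ M := by
  refine Subset.antisymm (fun f hf => ?_) (iUnion₂_subset fun A hA f hf => ?_)
  · obtain ⟨A, hA, hfA, hAM⟩ := h f hf
    exact mem_iUnion₂.2 ⟨A, ⟨hA, hAM⟩, hfA⟩
  · obtain ⟨C, hC⟩ := hA.2
    exact ⟨hf.1, (hC f hf).trans_lt (ENNReal.mul_lt_top (by simp) hf.2)⟩

theorem isUniformlySubDiagonal_of
    (h : ∀ f ∈ spaceOf M, ∃ A, IsYoung A ∧ f ∈ spaceOf (orliczNorm μ A) ∧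
      AlmostCompactlyEmbeds μ (orliczNorm μ A) M)
    (h' : ∀ A, IsYoung A → AlmostCompactlyEmbeds μ (orliczNorm μ A) M →
      spaceOf (orliczNorm μ A) ⊆ spaceOf M) : IsUniformlySubDiagonal μ M := by
  refine Subset.antisymm (fun f hf => ?_) (iUnion₂_subset fun A hA => h' A hA.1 hA.2)
  obtain ⟨A, hA, hfA, hAM⟩ := h f hf
  exact mem_iUnion₂.2 ⟨A, ⟨hA, hAM⟩, hfA⟩

theorem IsSubDiagonal.exists_subset (h : IsSubDiagonal μ M) (hf : f ∈ spaceOf M) :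
    ∃ A, IsYoung A ∧ f ∈ spaceOf (orliczNorm μ A) ∧
      spaceOf (orliczNorm μ A) ⊆ spaceOf M := by
  have hf' := h.subset hf
  obtain ⟨A, hA, hfA⟩ := mem_iUnion₂.1 hf'
  exact ⟨A, hA.1, hfA, fun g hg => h.superset (mem_iUnion₂.2 ⟨A, hA, hg⟩)⟩

theorem IsUniformlySubDiagonal.exists_subset (h : IsUniformlySubDiagonal μ M)
    (hf : f ∈ spaceOf M) :
    ∃ A, IsYoung A ∧ AlmostCompactlyEmbeds μ (orliczNorm μ A) M ∧
      f ∈ spaceOf (orliczNorm μ A) ∧ spaceOf (orliczNorm μ A) ⊆ spaceOf M := by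
  have hf' := h.subset hf
  obtain ⟨A, hA, hfA⟩ := mem_iUnion₂.1 hf'
  exact ⟨A, hA.1, hA.2, hfA, fun g hg => h.superset (mem_iUnion₂.2 ⟨A, hA, hg⟩)⟩

theorem spaceOf_congr (h : ∀ f, Measurable f → M f = M' f) : spaceOf M = spaceOf M' := by
  ext f
  simp only [spaceOf, mem_ofPred_eq]
  exact and_congr_right fun hf => by rw [h f hf]

theorem isSubDiagonal_congr (h : ∀ f, Measurable f → M f = M' f) :
    IsSubDiagonal μ M ↔ IsSubDiagonal μ M' := by
  have : ∀ A, Embeds (orliczNorm μ A) M ↔ Embeds (orliczNorm μ A) M' := fun A =>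
    exists_congr fun C => forall₂_congr fun f hf => by rw [h f hf.1]
  simp only [IsSubDiagonal, spaceOf_congr h, this]

theorem isUniformlySubDiagonal_congr (h : ∀ f, Measurable f → M f = M' f) :
    IsUniformlySubDiagonal μ M ↔ IsUniformlySubDiagonal μ M' := by
  have : ∀ A, AlmostCompactlyEmbeds μ (orliczNorm μ A) M ↔
      AlmostCompactlyEmbeds μ (orliczNorm μ A) M' := fun A => by
    refine forall_congr' fun S => forall_congr' fun hS => forall_congr' fun _ => ?_
    refine iff_of_eq (congrArg (Tendsto · _ _) (funext fun n => ?_))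
    exact iSup_congr fun f => iSup_congr fun hf => h _ (hf.1.1.indicator (hS n))
  simp only [IsUniformlySubDiagonal, spaceOf_congr h, this]

/-- On a finite measure space χ_{Eₙ} → 0 a.e. forces the measures of Eₙ to vanish, so uniform
smallness over sets of small measure suffices. The scale 2 may be any number above 1: norm at most 1
bounds the modular directly at larger scales. -/
theorem almostCompactlyEmbeds_orliczNorm [IsFiniteMeasure μ] (hA : IsYoung A)
    (h : ∀ ε : ℝ≥0∞, ε ≠ 0 → ε ≠ ∞ → ∃ δ > 0, ∀ S, MeasurableSet S → μ S ≤ δ →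
      ∀ f, Measurable f → orliczModular μ A f 2 ≤ 1 → M (S.indicator f) ≤ ε) :
    AlmostCompactlyEmbeds μ (orliczNorm μ A) M := by
  intro S hS hlim
  have hμ : Tendsto (fun n => μ (S n)) atTop (𝓝 0) := by
    have := tendsto_measure_of_ae_tendsto_indicator_of_isFiniteMeasure (μ := μ) (A := ∅) atTop
      MeasurableSet.empty hS ?_
    · simpa using this
    · filter_upwards [hlim] with x hx
      have := hx.eventually_lt_const (zero_lt_one' ℝ)
      filter_upwards [this] with n hn
      by_contra hc
      have hx : x ∈ S n := by simpa using hc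
      simp [hx] at hn
  refine ENNReal.tendsto_nhds_zero.2 fun ε hε => ?_
  obtain ⟨δ, hδ, hδ'⟩ := h (min ε 1) (by simp [hε.ne']) (by simp)
  filter_upwards [ENNReal.tendsto_nhds_zero.1 hμ δ hδ] with n hn
  refine iSup₂_le fun f hf => (hδ' (S n) (hS n) hn f hf.1.1 ?_).trans (min_le_left _ _)
  exact orliczModular_le_one_of_lt hA (lt_of_le_of_lt hf.2 (by norm_num))

/-- Uniform sub-diagonality is an equality of sets, but almost compactness supplies no norm
inequality for the inclusion of `L^A`. Scaled into the unit ball, f becomes an a.e. finite g whose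
parts above height n are eventually small in the target; `hM` says that a bounded part and a scaling
do no harm there. -/
theorem AlmostCompactlyEmbeds.spaceOf_subset (hA : IsYoung A)
    (h : AlmostCompactlyEmbeds μ (orliczNorm μ A) M)
    (hM : ∀ f g, Measurable f → Measurable g → ∀ s n : ℝ≥0, 0 < s →
      (∀ x, (n : ℝ≥0∞) < (f x).abs → (f x).abs ≤ (s : ℝ≥0∞) * (g x).abs) → M g < ∞ → M f < ∞) :
    spaceOf (orliczNorm μ A) ⊆ spaceOf M := by
  rintro f ⟨hf, hNf⟩
  refine ⟨hf, ?_⟩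
  obtain ⟨r, hr, -⟩ := ENNReal.lt_iff_exists_nnreal_btwn.1 hNf
  have hr0 : (r : ℝ≥0∞) ≠ 0 := (zero_le.trans_lt hr).ne'
  have hmod := orliczModular_le_one_of_lt hA hr
  set g : α → EReal := fun x => (((f x).abs / r : ℝ≥0∞) : EReal) with hg
  have hgm : Measurable g := (hf.ereal_abs.div_const _).coe_ereal_ennreal
  have hgabs : ∀ x, (g x).abs = (f x).abs / r := fun x => EReal.abs_coe_ennreal _
  have hNg : orliczNorm μ A g ≤ 1 := orliczNorm_le one_ne_zero ENNReal.one_ne_top (by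
    simpa [orliczModular, hgabs] using hmod)
  have hfin : ∀ᵐ x ∂μ, (f x).abs / r < ∞ := by
    have hm : Measurable fun x => A ((f x).abs / r) :=
      hA.measurable.comp (hf.ereal_abs.div_const _)
    filter_upwards [ae_lt_top hm (ne_top_of_le_ne_top ENNReal.one_ne_top hmod)] with x hx
    by_contra hc
    rw [not_lt_top_iff.1 hc, hA.map_top] at hx
    exact lt_irrefl _ hx
  have hlim := h (fun n : ℕ => {x | (n : ℝ≥0∞) < (g x).abs})
    (fun n => measurableSet_lt measurable_const hgm.ereal_abs) (by
      filter_upwards [hfin] with x hx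
      obtain ⟨N, hN⟩ := ENNReal.exists_nat_gt hx.ne
      refine tendsto_const_nhds.congr' ?_
      filter_upwards [eventually_ge_atTop N] with n hn
      have : ¬ (n : ℝ≥0∞) < (f x).abs / r :=
        not_lt.2 (hN.le.trans (by exact_mod_cast hn))
      simp [indicator, hgabs, this])
  obtain ⟨n, hn⟩ := (hlim.eventually_lt_const (zero_lt_one' ℝ≥0∞)).exists
  have hMn := (le_iSup₂_of_le (f := fun f (_ : f ∈ {f ∈ spaceOf (orliczNorm μ A) |
    orliczNorm μ A f ≤ 1}) => M ({x | (n : ℝ≥0∞) < (g x).abs}.indicator f)) g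
      ⟨⟨hgm, hNg.trans_lt ENNReal.one_lt_top⟩, hNg⟩ le_rfl).trans_lt hn
  refine hM f _ hf (hgm.indicator (measurableSet_lt measurable_const hgm.ereal_abs)) r (r * n)
    (pos_iff_ne_zero.2 (by exact_mod_cast hr0)) (fun x hx => ?_) (hMn.trans ENNReal.one_lt_top)
  have hx' : (n : ℝ≥0∞) < (g x).abs := by
    rw [hgabs, ENNReal.lt_div_iff_mul_lt (Or.inl hr0) (Or.inl (by simp)), mul_comm]
    exact_mod_cast hx
  rw [indicator_of_mem (by exact hx'), hgabs, ENNReal.mul_div_cancel hr0 (by simp)]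

end Framework

/-! ### Dilations and tails of integrals on the half-line -/

theorem lintegral_eq_mul_lintegral_comp_mul_left {c : ℝ} (hc : 0 < c) (F : ℝ → ℝ≥0∞) :
    ∫⁻ s, F s = ENNReal.ofReal c * ∫⁻ s, F (c * s) := by
  conv_lhs => rw [← Real.smul_map_volume_mul_left hc.ne']
  rw [lintegral_smul_measure, abs_of_pos hc, smul_eq_mul]
  congr 1
  exact (Homeomorph.mulLeft₀ c hc.ne').measurableEmbedding.lintegral_map F

theorem setLIntegral_Ioi_eq_mul {c : ℝ} (hc : 0 < c) (F : ℝ → ℝ≥0∞) :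
    ∫⁻ s in Ioi (0 : ℝ), F s = ENNReal.ofReal c * ∫⁻ s in Ioi (0 : ℝ), F (c * s) := by
  rw [← lintegral_indicator measurableSet_Ioi, lintegral_eq_mul_lintegral_comp_mul_left hc,
    ← lintegral_indicator measurableSet_Ioi]
  congr 2 with s
  simp [indicator, hc]

theorem tendsto_setLIntegral_Ioi_zero {F : ℝ → ℝ≥0∞} (hF : Measurable F)
    (hfin : ∫⁻ s in Ioi (0 : ℝ), F s ≠ ∞) :
    Tendsto (fun n : ℕ => ∫⁻ s in Ioi (n : ℝ), F s) atTop (𝓝 0) := by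
  have : Tendsto (fun n : ℕ => ∫⁻ s in Ioi (0 : ℝ), (Ioi (n : ℝ)).indicator F s) atTop
      (𝓝 (∫⁻ s in Ioi (0 : ℝ), 0)) := by
    refine tendsto_lintegral_of_dominated_convergence F
      (fun n => hF.indicator measurableSet_Ioi)
      (fun n => ae_of_all _ fun s => indicator_le_self _ _ _) hfin (ae_of_all _ fun s => ?_)
    obtain ⟨N, hN⟩ := exists_nat_ge s
    refine tendsto_const_nhds.congr' ?_
    filter_upwards [eventually_ge_atTop N] with n hn
    have : ¬ (n : ℝ) < s := not_lt.2 (hN.trans (by exact_mod_cast hn))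
    simp [indicator, this]
  rw [lintegral_zero] at this
  refine this.congr fun n => ?_
  rw [lintegral_indicator measurableSet_Ioi, Measure.restrict_restrict measurableSet_Ioi,
    inter_eq_left.2 (Ioi_subset_Ioi (Nat.cast_nonneg n))]

/-! ### Quasiconcave functions and their slopes -/

/-- Quasiconcave functions on `[0,1]`, non-degenerate at `1`. -/
structure IsQuasiconcave (φ : ℝ≥0∞ → ℝ≥0∞) : Prop where
  mono : Monotone φ
  map_zero : φ 0 = 0
  one_ne_zero : φ 1 ≠ 0
  one_ne_top : φ 1 ≠ ∞
  mul_le_mul : ∀ s t, s ≤ t → t ≤ 1 → φ t * s ≤ φ s * t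

/-- The generalized Lorentz functional `∫₀^∞ φ(h_*(s)) ds`. -/
noncomputable def layerIntegral {α : Type*} [MeasurableSpace α] (φ : ℝ≥0∞ → ℝ≥0∞)
    (μ : Measure α) (h : α → ℝ≥0∞) : ℝ≥0∞ :=
  ∫⁻ s in Ioi (0 : ℝ), φ (μ {x | ENNReal.ofReal s < h x})

/-- The functional `f ↦ (∫₀^∞ φ((|f|^q)_*(s)) ds)^{1/q}`. -/
noncomputable def layerNorm {α : Type*} [MeasurableSpace α] (φ : ℝ≥0∞ → ℝ≥0∞)
    (μ : Measure α) (q : ℝ) (f : α → EReal) : ℝ≥0∞ :=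
  layerIntegral φ μ (fun x => (f x).abs ^ q) ^ (1 / q)

/-- The slope `φ(d)/d`, infinite at `d = 0`. -/
noncomputable def meanSlope (φ : ℝ≥0∞ → ℝ≥0∞) (d : ℝ≥0∞) : ℝ≥0∞ :=
  if d = 0 then ∞ else φ d / d

theorem meanSlope_mul_le (φ : ℝ≥0∞ → ℝ≥0∞) (d : ℝ≥0∞) : meanSlope φ d * d ≤ φ d := by
  unfold meanSlope
  split_ifs with h
  · simp [h]
  · exact ENNReal.mul_le_of_le_div le_rfl

namespace IsQuasiconcave

variable {φ : ℝ≥0∞ → ℝ≥0∞}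

theorem slope_anti (hφ : IsQuasiconcave φ) {s t : ℝ≥0∞} (hst : s ≤ t) (ht : t ≤ 1) :
    meanSlope φ t ≤ meanSlope φ s := by
  unfold meanSlope
  by_cases hs : s = 0
  · simp [hs]
  · have ht0 : t ≠ 0 := fun h => hs (le_antisymm (h ▸ hst) zero_le)
    have htt : t ≠ ∞ := ne_top_of_le_ne_top ENNReal.one_ne_top ht
    have hsr : s ≠ ∞ := ne_top_of_le_ne_top htt hst
    rw [if_neg hs, if_neg ht0, ENNReal.div_le_iff ht0 htt, div_eq_mul_inv, mul_assoc,
      mul_comm s⁻¹, ← mul_assoc, ← div_eq_mul_inv, ENNReal.le_div_iff_mul_le (Or.inl hs)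
      (Or.inl hsr)]
    exact hφ.mul_le_mul s t hst ht

theorem le_slope (hφ : IsQuasiconcave φ) {s : ℝ≥0∞} (hs : s ≤ 1) : φ 1 ≤ meanSlope φ s := by
  simpa [meanSlope] using hφ.slope_anti hs le_rfl

theorem ne_zero (hφ : IsQuasiconcave φ) {s : ℝ≥0∞} (hs : s ≠ 0) : φ s ≠ 0 := by
  intro h
  have h1 : φ (min s 1) = 0 := le_antisymm (h ▸ hφ.mono (min_le_left _ _)) zero_le
  have := hφ.mul_le_mul (min s 1) 1 (min_le_right _ _) le_rfl
  rw [h1, zero_mul, nonpos_iff_eq_zero, mul_eq_zero] at this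
  rcases this with h | h
  · exact hφ.one_ne_zero h
  · rcases min_choice s 1 with h' | h' <;> rw [h'] at h
    · exact hs h
    · simp at h

/-- If u ≤ κd, monotonicity gives the first term; otherwise φ(u)/u ≤ φ(κd)/(κd) ≤ cφ(d)/d gives the
second. Embeddings use κ = c = 1, almost compactness κ = K^j and c = 2^{-j}. -/
theorem le_add_slope (hφ : IsQuasiconcave φ) {u d κ c : ℝ≥0∞} (hu : u ≤ 1)
    (hκ : κ ≠ 0) (hκt : κ ≠ ∞) (hc : c ≠ 0) (h : φ (κ * d) ≤ κ * c * φ d) :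
    φ u ≤ κ * c * φ d + c * (meanSlope φ d * u) := by
  rcases eq_or_ne u 0 with rfl | hu0
  · rw [hφ.map_zero]; exact zero_le
  rcases le_total u (κ * d) with hud | hud
  · exact (hφ.mono hud).trans (h.trans le_self_add)
  · rcases eq_or_ne d 0 with rfl | hd
    · simp [meanSlope, ENNReal.top_mul hu0, ENNReal.mul_top hc]
    · refine le_add_left ?_
      have hdt : d ≠ ∞ := by
        rintro rfl
        rw [ENNReal.mul_top hκ] at hud
        exact absurd (hud.trans hu) (by simp)
      have key : φ u * (κ * d) ≤ κ * c * φ d * u :=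
        (hφ.mul_le_mul _ _ hud hu).trans (by gcongr)
      rw [meanSlope, if_neg hd, ← ENNReal.mul_le_mul_iff_left (mul_ne_zero hκ hd)
        (ENNReal.mul_ne_top hκt hdt)]
      calc φ u * (κ * d) ≤ κ * c * φ d * u := key
        _ = κ * c * (φ d / d * d) * u := by rw [ENNReal.div_mul_cancel hd hdt]
        _ = _ := by ring

theorem iterate_doubling {K δ : ℝ≥0∞} (hK : 1 ≤ K)
    (h : ∀ t, K * t ≤ δ → 2 * φ (K * t) ≤ K * φ t) (j : ℕ) {t : ℝ≥0∞} (ht : K ^ j * t ≤ δ) :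
    φ (K ^ j * t) ≤ K ^ j * 2⁻¹ ^ j * φ t := by
  induction j with
  | zero => simp
  | succ j ih =>
    have hle : K ^ j * t ≤ K ^ (j + 1) * t := mul_le_mul_left (pow_le_pow_right₀ hK j.le_succ) t
    have h1 := h (K ^ j * t) (by rwa [← mul_assoc, ← pow_succ'])
    rw [← mul_assoc, ← pow_succ'] at h1
    calc φ (K ^ (j + 1) * t) = 2⁻¹ * (2 * φ (K ^ (j + 1) * t)) := by
          rw [← mul_assoc, ENNReal.inv_mul_cancel (by simp) (by simp), one_mul]
      _ ≤ 2⁻¹ * (K * (K ^ j * 2⁻¹ ^ j * φ t)) := by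
          exact mul_le_mul_right (h1.trans (mul_le_mul_right (ih (hle.trans ht)) K)) _
      _ = _ := by ring

end IsQuasiconcave

/-! ### Sub-diagonality of generalized Lorentz functionals -/

section LayerNorm

variable {α : Type*} [MeasurableSpace α] {μ : Measure α} {φ : ℝ≥0∞ → ℝ≥0∞}

theorem antitone_distribution (h : α → ℝ≥0∞) :
    Antitone fun s : ℝ => μ {x | ENNReal.ofReal s < h x} := fun _ _ hst =>
  measure_mono fun _ hx => (ENNReal.ofReal_le_ofReal hst).trans_lt hx

theorem layerIntegral_const_mul {c : ℝ≥0∞} (hc : c ≠ 0) (hct : c ≠ ∞) (h : α → ℝ≥0∞) :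
    layerIntegral φ μ (fun x => c * h x) = c * layerIntegral φ μ h := by
  have hc' : 0 < c.toReal := ENNReal.toReal_pos hc hct
  unfold layerIntegral
  rw [setLIntegral_Ioi_eq_mul hc', ENNReal.ofReal_toReal hct]
  congr 2 with s
  congr 3 with x
  rw [ENNReal.ofReal_mul hc'.le, ENNReal.ofReal_toReal hct, ENNReal.mul_lt_mul_iff_right hc hct]

/-- Levels below n contribute at most φ(1) each, since μ is a probability measure. -/
theorem layerIntegral_le_add [IsProbabilityMeasure μ] (hφ : IsQuasiconcave φ) {h k : α → ℝ≥0∞}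
    {n : ℝ≥0∞} (hhk : ∀ x, n < h x → h x ≤ k x) :
    layerIntegral φ μ h ≤ φ 1 * n + layerIntegral φ μ k := by
  rw [← primitive_const (φ 1) n]
  unfold primitive layerIntegral
  rw [← lintegral_add_left (measurable_const.indicator (measurableSet_ofReal_lt n))]
  refine lintegral_mono fun s => ?_
  by_cases hs : ENNReal.ofReal s < n
  · simp only [indicator, mem_ofPred_eq, hs, if_true]
    exact (hφ.mono prob_le_one).trans le_self_add
  · simp only [indicator, mem_ofPred_eq, hs, if_false, zero_add]
    exact hφ.mono (measure_mono fun x hx =>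
      lt_of_lt_of_le hx (hhk x ((not_lt.1 hs).trans_lt hx)))

/-- The density of the Young function which controls the functional `layerIntegral φ μ`. -/
noncomputable def youngDensity (φ : ℝ≥0∞ → ℝ≥0∞) (μ : Measure α) (F : α → ℝ≥0∞) (s : ℝ) : ℝ≥0∞ :=
  meanSlope φ (μ {x | ENNReal.ofReal s < F x})

theorem monotone_youngDensity [IsProbabilityMeasure μ] (hφ : IsQuasiconcave φ) (F : α → ℝ≥0∞) :
    Monotone (youngDensity φ μ F) := fun _ _ hst =>
  hφ.slope_anti (antitone_distribution F hst) prob_le_one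

/-- The bound F ≥ 1 keeps the density equal to φ(1) < ∞ at levels below 1, so the primitive is not
identically ∞. This is why |f|^q is replaced by its maximum with 1. -/
theorem isYoung_primitive_youngDensity [IsProbabilityMeasure μ] (hφ : IsQuasiconcave φ)
    {F : α → ℝ≥0∞} (hF : ∀ x, 1 ≤ F x) : IsYoung (primitive (youngDensity φ μ F)) := by
  refine IsYoung.primitive (monotone_youngDensity hφ F) hφ.one_ne_zero
    (fun s => hφ.le_slope prob_le_one) (r := 1 / 2) (by norm_num) ?_
  have : {x | ENNReal.ofReal (1 / 2) < F x} = univ :=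
    eq_univ_of_forall fun x => lt_of_lt_of_le (by
      rw [ENNReal.ofReal_lt_one]; norm_num) (hF x)
  rw [youngDensity, this, measure_univ, meanSlope]
  simpa using hφ.one_ne_top

theorem lintegral_primitive_youngDensity_le [IsProbabilityMeasure μ] (hφ : IsQuasiconcave φ)
    {F : α → ℝ≥0∞} (hF : Measurable F) :
    ∫⁻ x, primitive (youngDensity φ μ F) (F x) ∂μ ≤ layerIntegral φ μ F := by
  rw [lintegral_primitive (monotone_youngDensity hφ F).measurable hF]
  exact lintegral_mono fun s => meanSlope_mul_le φ _

theorem measurable_comp_distribution (hφ : IsQuasiconcave φ) (F : α → ℝ≥0∞) :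
    Measurable fun s : ℝ => φ (μ {x | ENNReal.ofReal s < F x}) :=
  (hφ.mono.comp_antitone (antitone_distribution F)).measurable

/-- The central estimate: `le_add_slope` at u = |{g > s}| and d = |{F > s}|, integrated in s. The
slope term becomes the modular of g by layer cake. -/
theorem setLIntegral_comp_distribution_le [IsProbabilityMeasure μ] (hφ : IsQuasiconcave φ)
    {F g : α → ℝ≥0∞} (hg : Measurable g) {κ c : ℝ≥0∞} (hκ : κ ≠ 0) (hκt : κ ≠ ∞)
    (hc : c ≠ 0) (hct : c ≠ ∞) {T : ℝ} (hT : 0 ≤ T)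
    (hd : ∀ s > T, φ (κ * μ {x | ENNReal.ofReal s < F x}) ≤
      κ * c * φ (μ {x | ENNReal.ofReal s < F x})) :
    ∫⁻ s in Ioi T, φ (μ {x | ENNReal.ofReal s < g x}) ≤
      κ * c * (∫⁻ s in Ioi T, φ (μ {x | ENNReal.ofReal s < F x})) +
        c * ∫⁻ x, primitive (youngDensity φ μ F) (g x) ∂μ := by
  rw [lintegral_primitive (monotone_youngDensity hφ F).measurable hg,
    ← lintegral_const_mul' _ _ (ENNReal.mul_ne_top hκt hct), ← lintegral_const_mul' c _ hct]
  refine (setLIntegral_mono' measurableSet_Ioi fun s hs =>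
    hφ.le_add_slope prob_le_one hκ hκt hc (hd s hs)).trans ?_
  rw [lintegral_add_left ((measurable_comp_distribution hφ F).const_mul _)]
  exact add_le_add le_rfl (lintegral_mono_set (Ioi_subset_Ioi hT))

variable {q : ℝ}

theorem layerNorm_lt_top_iff (hq : 0 < q) {f : α → EReal} :
    layerNorm φ μ q f < ∞ ↔ layerIntegral φ μ (fun x => (f x).abs ^ q) < ∞ := by
  rw [layerNorm, ENNReal.rpow_lt_top_iff_of_pos (by positivity)]

theorem layerNorm_le_mul (hq : 0 < q) {f : α → EReal} {s C : ℝ≥0∞} (hs : s ≠ 0) (hst : s ≠ ∞)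
    (h : layerIntegral φ μ (fun x => ((f x).abs / s) ^ q) ≤ C) :
    layerNorm φ μ q f ≤ C ^ (1 / q) * s := by
  have hfs : (fun x => (f x).abs ^ q) = fun x => s ^ q * ((f x).abs / s) ^ q := by
    ext x
    rw [← ENNReal.mul_rpow_of_nonneg _ _ hq.le, ENNReal.mul_div_cancel hs hst]
  have hsq : s ^ q ≠ 0 := by simp [hs, hst, hq]
  rw [layerNorm, hfs, layerIntegral_const_mul hsq (ENNReal.rpow_ne_top_of_nonneg hq.le hst),
    ENNReal.mul_rpow_of_nonneg _ _ (by positivity), ← ENNReal.rpow_mul, mul_one_div_cancel hq.ne',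
    ENNReal.rpow_one, mul_comm]
  gcongr

/-- The Young function which controls `layerNorm φ μ q` and whose Orlicz space contains `f`. -/
noncomputable def layerYoung (φ : ℝ≥0∞ → ℝ≥0∞) (μ : Measure α) (q : ℝ) (f : α → EReal)
    (t : ℝ≥0∞) : ℝ≥0∞ :=
  primitive (youngDensity φ μ fun x => max ((f x).abs ^ q) 1) (t ^ q)

theorem isYoung_layerYoung [IsProbabilityMeasure μ] (hφ : IsQuasiconcave φ) (hq : 1 ≤ q)
    (f : α → EReal) : IsYoung (layerYoung φ μ q f) :=
  (isYoung_primitive_youngDensity hφ fun _ => le_max_right _ _).comp (IsYoung.rpow hq)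

theorem layerIntegral_max_lt_top [IsProbabilityMeasure μ] (hφ : IsQuasiconcave φ) (hq : 0 < q)
    {f : α → EReal} (hf : layerNorm φ μ q f < ∞) :
    layerIntegral φ μ (fun x => max ((f x).abs ^ q) 1) < ∞ := by
  refine (layerIntegral_le_add hφ (n := 1) (k := fun x => (f x).abs ^ q) fun x hx => ?_).trans_lt
    (ENNReal.add_lt_top.2 ⟨?_, (layerNorm_lt_top_iff hq).1 hf⟩)
  · rcases lt_max_iff.1 hx with h | h
    · exact max_le le_rfl h.le
    · exact absurd h (lt_irrefl _)
  · rw [mul_one]; exact hφ.one_ne_top.lt_top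

theorem mem_spaceOf_layerYoung [IsProbabilityMeasure μ] (hφ : IsQuasiconcave φ) (hq : 1 ≤ q)
    {f : α → EReal} (hf : f ∈ spaceOf (layerNorm φ μ q)) :
    f ∈ spaceOf (orliczNorm μ (layerYoung φ μ q f)) := by
  refine mem_spaceOf_orliczNorm (isYoung_layerYoung hφ hq f) hf.1 one_ne_zero ENNReal.one_ne_top
    (ne_top_of_le_ne_top (layerIntegral_max_lt_top hφ (by linarith) hf.2).ne ?_)
  refine le_trans ?_ (lintegral_primitive_youngDensity_le hφ
    ((hf.1.ereal_abs.pow_const q).max measurable_const))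
  refine lintegral_mono fun x => ?_
  rw [div_one]
  exact primitive_mono (le_max_left _ _)

theorem isSubDiagonal_layerNorm [IsProbabilityMeasure μ] (hφ : IsQuasiconcave φ) (hq : 1 ≤ q) :
    IsSubDiagonal μ (layerNorm φ μ q) := by
  have hq0 : 0 < q := by linarith
  refine isSubDiagonal_of fun f hf => ⟨layerYoung φ μ q f, isYoung_layerYoung hφ hq f,
    mem_spaceOf_layerYoung hφ hq hf, ?_⟩
  set F : α → ℝ≥0∞ := fun x => max ((f x).abs ^ q) 1 with hF
  have hfin := layerIntegral_max_lt_top hφ hq0 hf.2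
  have hC : (layerIntegral φ μ F + 1) ^ (1 / q) ≠ ∞ :=
    ENNReal.rpow_ne_top_of_nonneg (by positivity) (ENNReal.add_ne_top.2 ⟨hfin.ne, by simp⟩)
  refine embeds_orliczNorm (C := ((layerIntegral φ μ F + 1) ^ (1 / q)).toNNReal)
    fun g hg s hs hst h1 => ?_
  rw [ENNReal.coe_toNNReal hC]
  refine layerNorm_le_mul hq0 hs hst ?_
  refine (setLIntegral_comp_distribution_le (F := F) hφ ((hg.ereal_abs.div_const s).pow_const q)
    (κ := 1) (c := 1) (by simp) (by simp) (by simp) (by simp) le_rfl (by simp)).trans ?_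
  rw [one_mul, one_mul, one_mul]
  exact add_le_add le_rfl h1

theorem exists_forall_distribution_le [IsProbabilityMeasure μ] (hφ : IsQuasiconcave φ)
    {F : α → ℝ≥0∞} (hfin : layerIntegral φ μ F ≠ ∞) {d : ℝ≥0∞} (hd : d ≠ 0) :
    ∃ T : ℝ, ∀ s ≥ T, μ {x | ENNReal.ofReal s < F x} ≤ d := by
  by_contra! hcon
  refine hfin (top_le_iff.1 ?_)
  calc ∞ = ∫⁻ _ in Ioi (0 : ℝ), φ d := by simp [ENNReal.mul_top (hφ.ne_zero hd)]
    _ ≤ layerIntegral φ μ F := lintegral_mono fun s => by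
      obtain ⟨t, hst, ht⟩ := hcon s
      exact hφ.mono (ht.le.trans (antitone_distribution F hst))

/-- The same Young function works as for plain sub-diagonality; doubling of φ near 0 only sharpens
the estimate at high levels. -/
theorem isUniformlySubDiagonal_layerNorm [IsProbabilityMeasure μ] (hφ : IsQuasiconcave φ)
    (hq : 1 ≤ q) (hlim : ∀ ε ≠ 0, ∃ δ > 0, φ δ ≤ ε) {K d : ℝ≥0∞} (hK : 1 ≤ K) (hKt : K ≠ ∞)
    (hd : d ≠ 0) (hdoubling : ∀ t, K * t ≤ d → 2 * φ (K * t) ≤ K * φ t) :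
    IsUniformlySubDiagonal μ (layerNorm φ μ q) := by
  have hq0 : 0 < q := by linarith
  refine isUniformlySubDiagonal_of (fun f hf => ⟨layerYoung φ μ q f, isYoung_layerYoung hφ hq f,
    mem_spaceOf_layerYoung hφ hq hf, ?_⟩) fun A hA hAM => hAM.spaceOf_subset hA ?_
  · refine almostCompactlyEmbeds_orliczNorm (isYoung_layerYoung hφ hq f) fun ε hε hεt => ?_
    set F : α → ℝ≥0∞ := fun x => max ((f x).abs ^ q) 1 with hF
    have hfin := layerIntegral_max_lt_top hφ hq0 hf.2
    -- Three errors have to fit: levels below n, the tail of F, and the modular of g.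
    set η := (ε / 2) ^ q / 3 with hη
    have hη0 : η ≠ 0 := by
      have : ε / 2 ≠ ∞ := (ENNReal.div_lt_top hεt (by simp)).ne
      simp [hη, hε, this, hq0, ENNReal.div_eq_zero_iff]
    obtain ⟨j, hj⟩ : ∃ j : ℕ, (2⁻¹ : ℝ≥0∞) ^ j < η := ENNReal.exists_inv_two_pow_lt hη0
    have hKj0 : K ^ j ≠ 0 := pow_ne_zero _ (zero_lt_one.trans_le hK).ne'
    have hKjt : K ^ j ≠ ∞ := ENNReal.pow_ne_top hKt
    have h2j0 : (2⁻¹ : ℝ≥0∞) ^ j ≠ 0 := pow_ne_zero _ (by simp)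
    have h2jt : (2⁻¹ : ℝ≥0∞) ^ j ≠ ∞ := ENNReal.pow_ne_top (by simp)
    -- Above T₀ the distribution of F is so small that all j doubling steps stay within the range d.
    obtain ⟨T₀, hT₀⟩ := exists_forall_distribution_le hφ hfin.ne (d := d / K ^ j)
      (by simp [ENNReal.div_eq_zero_iff, hd, hKjt])
    have htail := (ENNReal.Tendsto.const_mul (a := K ^ j * 2⁻¹ ^ j) (tendsto_setLIntegral_Ioi_zero
      (measurable_comp_distribution (μ := μ) hφ F) hfin.ne)
        (Or.inr (ENNReal.mul_ne_top hKjt h2jt)))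
    rw [mul_zero] at htail
    obtain ⟨n, hn, hnT⟩ := ((htail.eventually_lt_const (pos_iff_ne_zero.2 hη0)).and
      (eventually_ge_atTop ⌈T₀⌉₊)).exists
    -- On the n low levels the distribution of g restricted to S is at most |S| ≤ δ, contributing at
    -- most n·φ(δ) ≤ η.
    obtain ⟨δ, hδ, hφδ⟩ := hlim (η / n) (by simp [ENNReal.div_eq_zero_iff, hη0])
    refine ⟨δ, hδ, fun S hS hSδ g hg hg1 => ?_⟩
    have hdist : ∀ s > (n : ℝ), φ (K ^ j * μ {x | ENNReal.ofReal s < F x}) ≤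
        K ^ j * 2⁻¹ ^ j * φ (μ {x | ENNReal.ofReal s < F x}) := fun s hs => by
      refine IsQuasiconcave.iterate_doubling hK hdoubling j ?_
      have := hT₀ s ((Nat.ceil_le.1 hnT).trans hs.le)
      rwa [ENNReal.le_div_iff_mul_le (Or.inl hKj0) (Or.inl hKjt), mul_comm] at this
    have main : layerIntegral φ μ (fun x => ((S.indicator g x).abs / 2) ^ q) ≤ (ε / 2) ^ q := by
      have hset : ∀ s : ℝ, {x | ENNReal.ofReal s < ((S.indicator g x).abs / 2) ^ q} ⊆
          S ∩ {x | ENNReal.ofReal s < ((g x).abs / 2) ^ q} := fun s x hx => by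
        by_cases h : x ∈ S
        · exact ⟨h, by simpa [h] using hx⟩
        · simp [h, hq0] at hx
      unfold layerIntegral
      rw [← Ioc_union_Ioi_eq_Ioi (Nat.cast_nonneg n),
        lintegral_union measurableSet_Ioi (Ioc_disjoint_Ioi le_rfl)]
      have h1 : ∫⁻ s in Ioc (0 : ℝ) n,
          φ (μ {x | ENNReal.ofReal s < ((S.indicator g x).abs / 2) ^ q}) ≤ η := by
        calc _ ≤ ∫⁻ s in Ioc (0 : ℝ) n, η / n := lintegral_mono fun s =>
              (hφ.mono (((measure_mono ((hset s).trans inter_subset_left))).trans hSδ)).trans hφδ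
          _ ≤ η := by simpa using ENNReal.mul_le_of_le_div (le_refl (η / (n : ℝ≥0∞)))
      have h2 : ∫⁻ s in Ioi (n : ℝ),
          φ (μ {x | ENNReal.ofReal s < ((S.indicator g x).abs / 2) ^ q}) ≤ η + η := by
        refine (lintegral_mono fun s =>
          hφ.mono (measure_mono ((hset s).trans inter_subset_right))).trans ?_
        refine (setLIntegral_comp_distribution_le (F := F) hφ
          ((hg.ereal_abs.div_const 2).pow_const q) hKj0 hKjt h2j0 h2jt (Nat.cast_nonneg n)
          hdist).trans (add_le_add hn.le ?_)
        calc _ ≤ 2⁻¹ ^ j * 1 := mul_le_mul_right hg1 _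
          _ ≤ η := by rw [mul_one]; exact hj.le
      calc _ ≤ η + (η + η) := add_le_add h1 h2
        _ = (ε / 2) ^ q := by
          rw [← add_assoc, hη]; exact ENNReal.add_thirds _
    have := layerNorm_le_mul hq0 (by simp) (by simp) main
    rwa [← ENNReal.rpow_mul, mul_one_div_cancel hq0.ne', ENNReal.rpow_one,
      ENNReal.div_mul_cancel (by simp) (by simp)] at this
  · intro f g hf hg s n hs hfg hgfin
    rw [layerNorm_lt_top_iff hq0] at hgfin ⊢
    have hs0 : (s : ℝ≥0∞) ≠ 0 := by exact_mod_cast hs.ne'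
    refine (layerIntegral_le_add hφ (n := (n : ℝ≥0∞) ^ q)
      (k := fun x => (s : ℝ≥0∞) ^ q * (g x).abs ^ q) fun x hx => ?_).trans_lt ?_
    · rw [← ENNReal.mul_rpow_of_nonneg _ _ hq0.le]
      exact ENNReal.rpow_le_rpow (hfg x ((ENNReal.rpow_lt_rpow_iff hq0).1 hx)) hq0.le
    · have hst : (s : ℝ≥0∞) ^ q ≠ ∞ := ENNReal.rpow_ne_top_of_nonneg hq0.le (by simp)
      rw [layerIntegral_const_mul (by simp [hs0, hq0]) hst]
      exact ENNReal.add_lt_top.2 ⟨ENNReal.mul_lt_top hφ.one_ne_top.lt_top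
        (ENNReal.rpow_lt_top_of_nonneg hq0.le (by simp)), ENNReal.mul_lt_top hst.lt_top hgfin⟩

end LayerNorm

/-! ### The quasiconcave function of the Lorentz endpoint space -/

section Correlative

variable {E : ℝ≥0∞ → ℝ≥0∞}

theorem rightInv_mono : Monotone (rightInv E) := fun _ _ hst =>
  sSup_le_sSup fun _ hτ => le_trans hτ hst

/-- E(τ) ≤ 1/s gives E((s/t)τ) ≤ (s/t)E(τ) ≤ 1/t by convexity. This is the quasiconcavity of the
correlative before taking reciprocals. -/
theorem rightInv_le_mul (hE : IsYoung E) {s t : ℝ≥0∞} (hs : s ≠ 0) (hst : s ≤ t) (ht : t ≠ ∞) :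
    rightInv E s⁻¹ ≤ rightInv E t⁻¹ * (t / s) := by
  have ht0 : t ≠ 0 := fun h => hs (le_antisymm (h ▸ hst) zero_le)
  have hst' : s ≠ ∞ := ne_top_of_le_ne_top ht hst
  refine sSup_le fun τ hτ => ?_
  have h1 : s / t * τ ≤ rightInv E t⁻¹ := le_sSup <| by
    calc E (s / t * τ) ≤ s / t * E τ :=
          hE.map_mul_le (ENNReal.div_le_of_le_mul (by simpa using hst)) τ
      _ ≤ s / t * s⁻¹ := mul_le_mul_right hτ _
      _ = t⁻¹ := by
        rw [mul_comm, div_eq_mul_inv, ← mul_assoc, ENNReal.inv_mul_cancel hs hst', one_mul]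
  calc τ = s / t * τ * (t / s) := by
        rw [mul_comm (s / t), mul_assoc, div_eq_mul_inv, div_eq_mul_inv, mul_assoc,
          ← mul_assoc t⁻¹, ENNReal.inv_mul_cancel ht0 ht, one_mul, ENNReal.mul_inv_cancel hs hst',
          mul_one]
    _ ≤ _ := mul_le_mul_left h1 _

theorem isQuasiconcave_correlative (hE : IsYoung E) :
    IsQuasiconcave (correlative (rightInv E)) where
  mono _ _ hst := ENNReal.inv_le_inv.2 (rightInv_mono (ENNReal.inv_le_inv.2 hst))
  map_zero := by simp [correlative, rightInv]
  one_ne_zero := by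
    obtain ⟨t, -, ht⟩ := hE.exists_gt ENNReal.one_ne_top
    have : rightInv E 1 ≤ t := sSup_le fun τ hτ => by
      by_contra! h
      exact absurd ((ht.trans_le (hE.monotone h.le)).trans_le hτ) (lt_irrefl _)
    simpa [correlative] using ne_top_of_le_ne_top ENNReal.coe_ne_top this
  one_ne_top := by
    obtain ⟨t, ht0, -, ht⟩ := hE.exists_lt one_ne_zero
    have : t ≤ rightInv E 1 := le_sSup (by exact ht.le)
    simpa [correlative] using (ht0.trans_le this).ne'
  mul_le_mul s t hst ht := by
    rcases eq_or_ne s 0 with rfl | hs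
    · simp
    have htt := ne_top_of_le_ne_top ENNReal.one_ne_top ht
    have ht0 : t ≠ 0 := fun h => hs (le_antisymm (h ▸ hst) zero_le)
    have hst' : s ≠ ∞ := ne_top_of_le_ne_top htt hst
    have h1 := ENNReal.inv_le_inv.2 (rightInv_le_mul hE hs hst htt)
    rw [ENNReal.mul_inv (Or.inr (ENNReal.div_ne_top htt hs))
      (Or.inr (by simp [ENNReal.div_eq_zero_iff, ht0, hst'])),
      ENNReal.inv_div (Or.inl hst') (Or.inl hs)] at h1
    calc correlative (rightInv E) t * s = (rightInv E t⁻¹)⁻¹ * (s / t) * t := by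
          rw [mul_assoc, ENNReal.div_mul_cancel ht0 htt]; rfl
      _ ≤ _ := mul_le_mul_left h1 t

theorem exists_correlative_le (hfin : IsFiniteValued E) {ε : ℝ≥0∞} (hε : ε ≠ 0) :
    ∃ δ > 0, correlative (rightInv E) δ ≤ ε := by
  have h := hfin ε⁻¹.toNNReal
  rw [ENNReal.coe_toNNReal (by simpa using hε)] at h
  refine ⟨(E ε⁻¹)⁻¹, by simpa using h.ne, ?_⟩
  rw [correlative, inv_inv, ENNReal.inv_le_iff_inv_le]
  exact le_sSup (le_refl (E ε⁻¹))

/-- Passing to the inverse turns ∇₂ for E at infinity into doubling of the correlative at 0, with K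
= 2c. -/
theorem NablaTwoNearInfinity.exists_doubling (hE : IsYoung E) (hfin : IsFiniteValued E)
    (h : NablaTwoNearInfinity E) :
    ∃ K d : ℝ≥0∞, 1 ≤ K ∧ K ≠ ∞ ∧ d ≠ 0 ∧ ∀ t, K * t ≤ d →
      2 * correlative (rightInv E) (K * t) ≤ K * correlative (rightInv E) t := by
  obtain ⟨c, hc, t₀, ht₀⟩ := h
  have hc0 : (c : ℝ≥0∞) ≠ 0 := by exact_mod_cast hc.ne'
  have hc1 : 1 ≤ c := by
    -- If c < 1, convexity gives 2cE(t) ≤ E(ct) ≤ cE(t), impossible where 0 < E(t) < ∞.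
    by_contra! hc1
    obtain ⟨t₁, -, ht₁⟩ := hE.exists_gt (K := 0) (by simp)
    set t := max t₀ t₁
    have hEt : E t ≠ 0 := (ht₁.trans_le (hE.monotone (by
      exact_mod_cast le_max_right t₀ t₁))).ne'
    have h1 := (ht₀ t (le_max_left _ _)).trans (hE.map_mul_le (by exact_mod_cast hc1.le) t)
    rw [mul_assoc, two_mul] at h1
    have h2 : (c : ℝ≥0∞) * E t ≠ ∞ := ENNReal.mul_ne_top (by simp) (hfin t).ne
    exact absurd h1 (ENNReal.lt_add_right h2 (mul_ne_zero hc0 hEt)).not_ge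
  -- The range (E(t₀) + 1)⁻¹ ensures E(t₀) ≤ 1/(2ct), which settles arguments below t₀, where ∇₂
  -- says nothing; the added 1 covers E(t₀) = 0.
  refine ⟨2 * c, (E t₀ + 1)⁻¹, ?_, ENNReal.mul_ne_top (by simp) (by simp), ?_, fun t ht => ?_⟩
  · have : (1 : ℝ≥0) ≤ 2 * c := by
      calc (1 : ℝ≥0) ≤ c := hc1
        _ ≤ 2 * c := le_mul_of_one_le_left zero_le (by norm_num)
    exact_mod_cast this
  · simpa using (hfin t₀).ne
  rw [mul_assoc 2 (c : ℝ≥0∞) (correlative _ _)]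
  refine mul_le_mul_right ?_ (2 : ℝ≥0∞)
  rcases eq_or_ne t 0 with rfl | ht0
  · simp [(isQuasiconcave_correlative hE).map_zero]
  have h20 : (2 : ℝ≥0∞) * c ≠ 0 := by simp [hc0]
  have h2t : (2 : ℝ≥0∞) * c ≠ ∞ := ENNReal.mul_ne_top (by simp) (by simp)
  have hu : E t₀ ≤ (2 * c * t)⁻¹ := by
    rw [ENNReal.le_inv_iff_le_inv]
    exact ht.trans (ENNReal.inv_le_inv.2 le_self_add)
  have key : rightInv E t⁻¹ ≤ c * rightInv E (2 * c * t)⁻¹ := by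
    refine sSup_le fun τ hτ => ?_
    have hτt : τ ≠ ∞ := by
      rintro rfl
      have : E ∞ ≤ t⁻¹ := hτ
      rw [hE.map_top, top_le_iff, ENNReal.inv_eq_top] at this
      exact ht0 this
    lift τ to ℝ≥0 using hτt
    have hστ : c * (τ / c) = τ := mul_div_cancel₀ τ hc.ne'
    have hσ : ((τ / c : ℝ≥0) : ℝ≥0∞) ≤ rightInv E (2 * c * t)⁻¹ := le_sSup <| by
      show E _ ≤ _
      rcases le_total t₀ (τ / c) with h | h
      · have h1 := ht₀ _ h
        rw [← ENNReal.coe_mul, hστ] at h1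
        have h2 : 2 * (c : ℝ≥0∞) * E (τ / c : ℝ≥0) ≤ t⁻¹ := h1.trans hτ
        rw [ENNReal.mul_inv (Or.inl h20) (Or.inl h2t), mul_comm, ← div_eq_mul_inv,
          ENNReal.le_div_iff_mul_le (Or.inl h20) (Or.inl h2t), mul_comm]
        exact h2
      · exact (hE.monotone (by exact_mod_cast h)).trans hu
    calc (τ : ℝ≥0∞) = c * (τ / c : ℝ≥0) := by rw [← ENNReal.coe_mul, hστ]
      _ ≤ _ := mul_le_mul_right hσ _
  unfold correlative
  have h1 := mul_le_mul_right (ENNReal.inv_le_inv.2 key) (c : ℝ≥0∞)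
  rw [ENNReal.mul_inv (Or.inl hc0) (Or.inl (by simp)), ← mul_assoc,
    ENNReal.mul_inv_cancel hc0 (by simp), one_mul] at h1
  exact h1

theorem lorentzEndpointNorm_eq_layerNorm {α : Type*} [MeasurableSpace α] (μ : Measure α)
    (E : ℝ≥0∞ → ℝ≥0∞) :
    lorentzEndpointNorm μ E = layerNorm (correlative (rightInv E)) μ 1 := by
  ext f
  simp [lorentzEndpointNorm, layerNorm, layerIntegral, distrib]

end Correlative

/-! ### Primitives of non-increasing weights -/

section Primitive

variable {a : ℝ → ℝ≥0∞}

theorem primitive_mul {c : ℝ} (hc : 0 < c) (t : ℝ≥0∞) :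
    primitive a (ENNReal.ofReal c * t) = ENNReal.ofReal c * primitive (fun r => a (c * r)) t := by
  unfold primitive
  rw [setLIntegral_Ioi_eq_mul hc]
  congr 2 with r
  have : ENNReal.ofReal (c * r) < ENNReal.ofReal c * t ↔ ENNReal.ofReal r < t := by
    rw [ENNReal.ofReal_mul hc.le,
      ENNReal.mul_lt_mul_iff_right (by simpa using hc) ENNReal.ofReal_ne_top]
  simp only [indicator, mem_ofPred_eq, this]

theorem exists_primitive_le (ha : primitive a 1 ≠ ∞) {ε : ℝ≥0∞} (hε : ε ≠ 0) :
    ∃ δ > 0, primitive a δ ≤ ε := by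
  obtain ⟨δ, hδ, h⟩ := exists_pos_setLIntegral_lt_of_measure_lt ha hε
  obtain ⟨r, hr0, hr⟩ := exists_between (lt_min hδ one_pos)
  refine ⟨r, hr0, le_trans ?_ (h {s | ENNReal.ofReal s < r} ?_).le⟩
  · rw [← lintegral_indicator (measurableSet_ofReal_lt r)]
    refine lintegral_mono fun s => ?_
    by_cases hs : ENNReal.ofReal s < r
    · have hs1 : s ∈ {s : ℝ | ENNReal.ofReal s < 1} := hs.trans (hr.trans_le (min_le_right δ 1))
      have hs2 : s ∈ {s : ℝ | ENNReal.ofReal s < r} := hs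
      rw [indicator_of_mem hs2, indicator_of_mem hs2, indicator_of_mem hs1]
    · simp [indicator, hs]
  · rw [volume_ofReal_lt]
    exact hr.trans_le (min_le_left _ _)

theorem isQuasiconcave_primitive (ha : Antitone a) {r : ℝ} (hr : 0 < r) (hr1 : r ≤ 1)
    (har : a r ≠ 0) (hfin : primitive a 1 ≠ ∞) : IsQuasiconcave (primitive a) where
  mono := primitive_mono
  map_zero := primitive_zero
  one_ne_zero := by
    have : a r * ENNReal.ofReal r ≤ primitive a 1 := by
      rw [← primitive_const]
      refine lintegral_mono fun s => ?_
      by_cases h : ENNReal.ofReal s < ENNReal.ofReal r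
      · have h1 : ENNReal.ofReal s < 1 := h.trans_le (by simpa using hr1)
        rw [indicator_of_mem (by exact h), indicator_of_mem (by exact h1)]
        exact ha ((ENNReal.ofReal_lt_ofReal_iff hr).1 h).le
      · simp [indicator, h]
    exact ((pos_iff_ne_zero.2 (mul_ne_zero har (by simpa using hr))).trans_le this).ne'
  one_ne_top := hfin
  mul_le_mul s t hst ht := by
    rcases eq_or_ne s 0 with rfl | hs
    · simp
    have htt := ne_top_of_le_ne_top ENNReal.one_ne_top ht
    have ht0 : t ≠ 0 := fun h => hs (le_antisymm (h ▸ hst) zero_le)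
    have hst' : s ≠ ∞ := ne_top_of_le_ne_top htt hst
    have hctop : s / t ≠ ∞ := ENNReal.div_ne_top hst' ht0
    have hle : s / t ≤ 1 := ENNReal.div_le_of_le_mul (by simpa using hst)
    have hc : 0 < (s / t).toReal :=
      ENNReal.toReal_pos (by simp [ENNReal.div_eq_zero_iff, hs, htt]) hctop
    have h1 : (s / t).toReal ≤ 1 := by simpa using ENNReal.toReal_mono (by simp) hle
    have hmul := primitive_mul (a := a) hc t
    rw [ENNReal.ofReal_toReal hctop, ENNReal.div_mul_cancel ht0 htt] at hmul
    have hmono : primitive a t ≤ primitive (fun r => a ((s / t).toReal * r)) t := by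
      refine setLIntegral_mono' measurableSet_Ioi fun r hr => indicator_le_indicator (ha ?_)
      exact mul_le_of_le_one_left (le_of_lt hr) h1
    calc primitive a t * s = s / t * primitive a t * t := by
          rw [mul_right_comm, ENNReal.div_mul_cancel ht0 htt, mul_comm]
      _ ≤ _ := by rw [hmul]; exact mul_le_mul_left (mul_le_mul_right hmono _) _

theorem primitive_doubling {c : ℝ} (hc : 0 < c) (h : ∀ r > 0, 2 * a (c * r) ≤ a r) (t : ℝ≥0∞) :
    2 * primitive a (ENNReal.ofReal c * t) ≤ ENNReal.ofReal c * primitive a t := by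
  rw [primitive_mul hc, mul_left_comm]
  refine mul_le_mul_right ?_ _
  unfold primitive
  rw [← lintegral_const_mul' _ _ (by simp)]
  refine setLIntegral_mono' measurableSet_Ioi fun r hr => ?_
  by_cases hs : ENNReal.ofReal r < t
  · simpa [indicator, hs] using h r hr
  · simp [indicator, hs]

end Primitive

/-! ### Rearrangements; classical Lorentz functionals in layer form -/

section Rearrangement

variable {α : Type*} [MeasurableSpace α] {μ : Measure α} {f : α → EReal}

/-- The backward direction is right-continuity of the distribution function, by continuity of μ
along increasing sets. -/
theorem lt_rearr_iff {s t : ℝ≥0∞} : s < rearr μ f t ↔ t < distrib μ f s := by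
  constructor
  · intro h
    by_contra! hc
    exact absurd (sInf_le hc : rearr μ f t ≤ s) h.not_ge
  · intro h
    have hs : s < ∞ := by
      by_contra! hc
      rw [top_le_iff.1 hc] at h
      simp [distrib] at h
    obtain ⟨u, hu, hus, hlim⟩ := exists_seq_strictAnti_tendsto' hs
    have hUnion : {x | s < (f x).abs} = ⋃ n, {x | u n < (f x).abs} := by
      ext x
      simp only [mem_ofPred_eq, mem_iUnion]
      exact ⟨fun hx => (hlim.eventually_lt_const hx).exists,
        fun ⟨n, hn⟩ => (hus n).1.trans hn⟩
    have hmono : Monotone fun n => {x | u n < (f x).abs} := fun m n hmn x hx =>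
      (hu.antitone hmn).trans_lt hx
    rw [distrib, hUnion, hmono.measure_iUnion, lt_iSup_iff] at h
    obtain ⟨n, hn⟩ := h
    refine (hus n).1.trans_le (le_sInf fun v hv => ?_)
    by_contra! hc
    exact absurd (hn.trans_le ((measure_mono fun x hx => hc.trans hx).trans hv)) (lt_irrefl _)

theorem rearr_eq_zero [IsProbabilityMeasure μ] {t : ℝ≥0∞} (ht : 1 ≤ t) : rearr μ f t = 0 := by
  by_contra h
  exact absurd (lt_rearr_iff.1 (pos_iff_ne_zero.2 h)) (prob_le_one.trans ht).not_gt

theorem antitone_rearr : Antitone (rearr μ f) := fun _ _ hst =>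
  sInf_le_sInf fun _ hs => le_trans hs hst

/-- An antitone extension to `ℝ` of a non-increasing weight on `(0,1)`. -/
noncomputable def extendWeight (w : ℝ → ℝ) (r : ℝ) : ℝ≥0∞ :=
  if r ≤ 0 then ∞ else if r < 1 then ENNReal.ofReal (w r) else 0

variable {w : ℝ → ℝ}

theorem extendWeight_of_mem {r : ℝ} (hr : r ∈ Ioo (0 : ℝ) 1) :
    extendWeight w r = ENNReal.ofReal (w r) := by
  simp [extendWeight, hr.1.not_ge, hr.2]

theorem extendWeight_of_one_le {r : ℝ} (hr : 1 ≤ r) : extendWeight w r = 0 := by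
  simp [extendWeight, (zero_lt_one.trans_le hr).not_ge, hr.not_gt]

theorem antitone_extendWeight (hw : AntitoneOn w (Ioo 0 1)) : Antitone (extendWeight w) := by
  intro r s hrs
  rcases le_or_gt r 0 with hr | hr
  · simp [extendWeight, hr]
  rcases lt_or_ge s 1 with hs | hs
  · rw [extendWeight_of_mem ⟨hr, hrs.trans_lt hs⟩, extendWeight_of_mem ⟨hr.trans_le hrs, hs⟩]
    exact ENNReal.ofReal_le_ofReal (hw ⟨hr, hrs.trans_lt hs⟩ ⟨hr.trans_le hrs, hs⟩ hrs)
  · rw [extendWeight_of_one_le hs]; exact zero_le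

theorem primitive_extendWeight_one_ne_top (hw : IntegrableOn w (Ioo 0 1)) :
    primitive (extendWeight w) 1 ≠ ∞ := by
  refine ne_top_of_le_ne_top (Integrable.lintegral_lt_top hw).ne ?_
  rw [← lintegral_indicator measurableSet_Ioo, primitive, ← lintegral_indicator measurableSet_Ioi]
  refine lintegral_mono fun r => ?_
  by_cases h0 : 0 < r
  · by_cases h1 : r < 1
    · have h2 : r ∈ {s : ℝ | ENNReal.ofReal s < 1} := ENNReal.ofReal_lt_one.2 h1
      rw [indicator_of_mem (mem_Ioi.2 h0), indicator_of_mem (mem_Ioo.2 ⟨h0, h1⟩),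
        indicator_of_mem h2, extendWeight_of_mem ⟨h0, h1⟩]
    · simp [indicator, h1]
  · simp [indicator, h0]

theorem isQuasiconcave_primitive_extendWeight (hw_anti : AntitoneOn w (Ioo 0 1))
    (hw_pos : ∀ t ∈ Ioo (0 : ℝ) 1, 0 < w t) (hw_int : IntegrableOn w (Ioo 0 1)) :
    IsQuasiconcave (primitive (extendWeight w)) := by
  refine isQuasiconcave_primitive (antitone_extendWeight hw_anti) (r := 1 / 2) (by norm_num)
    (by norm_num) ?_ (primitive_extendWeight_one_ne_top hw_int)
  have h : (1 / 2 : ℝ) ∈ Ioo (0 : ℝ) 1 := by norm_num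
  rw [extendWeight_of_mem h]
  simpa using hw_pos _ h

/-- Layer cake for f^* under the measure w dt: by `lt_rearr_iff` each superlevel set of f^* is an
initial interval as long as the corresponding superlevel set of f. Values of w beyond 1 are
harmless, as f^* vanishes there. -/
theorem classicalLorentzNorm_eq_layerNorm [IsProbabilityMeasure μ]
    (hw : AntitoneOn w (Ioo 0 1)) {q : ℝ} (hq : 0 < q) (f : α → EReal) :
    classicalLorentzNorm μ q w f = layerNorm (primitive (extendWeight w)) μ q f := by
  have ha := (antitone_extendWeight hw).measurable
  have hR : Measurable fun t : ℝ => rearr μ f (ENNReal.ofReal t) ^ q :=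
    (Antitone.measurable fun _ _ hst =>
      antitone_rearr (ENNReal.ofReal_le_ofReal hst)).pow_const q
  unfold classicalLorentzNorm layerNorm
  congr 1
  calc ∫⁻ t in Ioi (0 : ℝ), rearr μ f (ENNReal.ofReal t) ^ q * ENNReal.ofReal (w t)
      = ∫⁻ t in Ioi (0 : ℝ), extendWeight w t * rearr μ f (ENNReal.ofReal t) ^ q := by
        refine setLIntegral_congr_fun measurableSet_Ioi fun t ht => ?_
        rcases lt_or_ge t 1 with h1 | h1
        · rw [extendWeight_of_mem ⟨ht, h1⟩, mul_comm]
        · simp [rearr_eq_zero (μ := μ) (f := f) (ENNReal.one_le_ofReal.2 h1), hq]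
    _ = ∫⁻ t, primitive (fun _ => 1) (rearr μ f (ENNReal.ofReal t) ^ q)
          ∂(volume.restrict (Ioi (0 : ℝ))).withDensity (extendWeight w) := by
        rw [lintegral_withDensity_eq_lintegral_mul _ ha (by
          simpa [primitive_const] using hR)]
        simp [primitive_const]
    _ = _ := by
        rw [lintegral_primitive measurable_const hR]
        unfold layerIntegral
        refine lintegral_congr fun s => ?_
        have hset : {t : ℝ | ENNReal.ofReal s < rearr μ f (ENNReal.ofReal t) ^ q} =
            {t | ENNReal.ofReal t < μ {x | ENNReal.ofReal s < (f x).abs ^ q}} := by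
          ext t
          simp only [mem_ofPred_eq, ← ENNReal.rpow_inv_lt_iff hq]
          exact lt_rearr_iff
        rw [hset, withDensity_apply _ (measurableSet_ofReal_lt _), one_mul, primitive,
          lintegral_indicator (measurableSet_ofReal_lt _)]

end Rearrangement

/-! ### De la Vallée Poussin's theorem -/

section DeLaValleePoussin

variable {α : Type*} [MeasurableSpace α] {μ : Measure α}

/-- A density of a superlinear Young function. -/
noncomputable def countDensity (n : ℕ → ℕ) (s : ℝ) : ℝ≥0∞ :=
  1 + ∑' k, (Ioi (n k : ℝ)).indicator 1 s

theorem monotone_countDensity (n : ℕ → ℕ) : Monotone (countDensity n) := fun s t hst => by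
  refine add_le_add le_rfl (ENNReal.tsum_le_tsum fun k => ?_)
  by_cases h : (n k : ℝ) < s
  · rw [indicator_of_mem (mem_Ioi.2 h), indicator_of_mem (mem_Ioi.2 (h.trans_le hst))]
    rfl
  · rw [indicator_of_notMem (by simpa using h)]
    exact zero_le

/-- The density counts how many thresholds n_k lie below s. Choosing n_k with tail integral at most
2^{-k} keeps the total finite, while beyond the first K thresholds the density is at least K. -/
theorem exists_isYoung_superlinear [SFinite μ] {h : α → ℝ≥0∞} (hm : Measurable h)
    (hfin : ∫⁻ x, h x ∂μ ≠ ∞) :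
    ∃ Φ, IsYoung Φ ∧ ∫⁻ x, Φ (h x) ∂μ ≠ ∞ ∧
      ∀ K : ℕ, ∃ L : ℝ≥0∞, L ≠ ∞ ∧ ∀ t, K * t ≤ Φ t + L := by
  have hlayer : ∫⁻ x, h x ∂μ = ∫⁻ s in Ioi (0 : ℝ), μ {x | ENNReal.ofReal s < h x} := by
    simpa [primitive_const] using lintegral_primitive (μ := μ) (a := fun _ => 1)
      measurable_const hm
  have hD : Measurable fun s : ℝ => μ {x | ENNReal.ofReal s < h x} :=
    (antitone_distribution h).measurable
  have htail := tendsto_setLIntegral_Ioi_zero hD (hlayer ▸ hfin)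
  have hex : ∀ k : ℕ, ∃ n : ℕ, 1 ≤ n ∧
      ∫⁻ s in Ioi (n : ℝ), μ {x | ENNReal.ofReal s < h x} ≤ 2⁻¹ ^ k := fun k => by
    obtain ⟨n, hn, hn1⟩ := ((ENNReal.tendsto_nhds_zero.1 htail (2⁻¹ ^ k)
      (by simp [ENNReal.pow_pos])).and (eventually_ge_atTop 1)).exists
    exact ⟨n, hn1, hn⟩
  choose n hn1 hn using hex
  have hmono := monotone_countDensity n
  refine ⟨primitive (countDensity n), IsYoung.primitive hmono one_ne_zero
    (fun s => le_self_add) (r := 1) one_pos ?_, ?_, fun K => ?_⟩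
  · have : ∀ k, (Ioi (n k : ℝ)).indicator (1 : ℝ → ℝ≥0∞) 1 = 0 := fun k =>
      indicator_of_notMem (by simpa using Nat.pos_iff_ne_zero.1 (hn1 k)) _
    simp [countDensity, this]
  · rw [lintegral_primitive hmono.measurable hm]
    have hle : ∫⁻ s in Ioi (0 : ℝ), countDensity n s * μ {x | ENNReal.ofReal s < h x} =
        ∫⁻ x, h x ∂μ + ∑' k, ∫⁻ s in Ioi (n k : ℝ), μ {x | ENNReal.ofReal s < h x} := by
      have : ∀ s, countDensity n s * μ {x | ENNReal.ofReal s < h x} =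
          μ {x | ENNReal.ofReal s < h x} +
          ∑' k, (Ioi (n k : ℝ)).indicator (fun s => μ {x | ENNReal.ofReal s < h x}) s := by
        intro s
        rw [countDensity, add_mul, one_mul, ← ENNReal.tsum_mul_right]
        congr 2 with k
        by_cases hs : (n k : ℝ) < s <;> simp [indicator, hs]
      simp_rw [this]
      rw [lintegral_add_left hD, hlayer, lintegral_tsum fun k =>
        (hD.indicator measurableSet_Ioi).aemeasurable]
      congr 2 with k
      rw [lintegral_indicator measurableSet_Ioi, Measure.restrict_restrict measurableSet_Ioi,
        inter_eq_left.2 (Ioi_subset_Ioi (Nat.cast_nonneg _))]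
    rw [hle]
    refine ENNReal.add_ne_top.2 ⟨hfin, ne_top_of_le_ne_top ?_ (ENNReal.tsum_le_tsum hn)⟩
    rw [ENNReal.tsum_geometric]
    simp
  · set N := (Finset.range K).sup n
    refine ⟨K * (N + 1), ENNReal.mul_ne_top (by simp) (by simp), fun t => ?_⟩
    rw [← primitive_const, ← primitive_const]
    unfold primitive
    rw [← lintegral_add_left (hmono.measurable.indicator (measurableSet_ofReal_lt _))]
    refine lintegral_mono fun s => ?_
    by_cases hst : ENNReal.ofReal s < t
    swap
    · simp [indicator, hst]
    by_cases hsN : ENNReal.ofReal s < N + 1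
    · simp [indicator, hst, hsN]
    · have hs : (N : ℝ) < s := by
        by_contra! hc
        refine hsN ((ENNReal.ofReal_le_ofReal hc).trans_lt ?_)
        rw [ENNReal.ofReal_natCast]
        exact ENNReal.lt_add_right (by simp) one_ne_zero
      simp only [indicator, mem_ofPred_eq, hst, hsN, if_true, if_false, add_zero]
      calc (K : ℝ≥0∞) = ∑ k ∈ Finset.range K, (Ioi (n k : ℝ)).indicator (1 : ℝ → ℝ≥0∞) s := by
            rw [Finset.sum_congr rfl (g := fun _ => 1)]
            · simp
            · intro k hk
              refine indicator_of_mem (lt_of_le_of_lt ?_ hs) _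
              exact_mod_cast Finset.le_sup hk
        _ ≤ ∑' k, (Ioi (n k : ℝ)).indicator (1 : ℝ → ℝ≥0∞) s := ENNReal.sum_le_tsum _
        _ ≤ countDensity n s := le_add_self

end DeLaValleePoussin

/-! ### Orlicz spaces: sufficiency of Δ₂, and smallness of tails -/

section Orlicz

variable {α : Type*} [MeasurableSpace α] {μ : Measure α} {E : ℝ≥0∞ → ℝ≥0∞}

theorem isSubDiagonal_orliczNorm (hE : IsYoung E) : IsSubDiagonal μ (orliczNorm μ E) :=
  isSubDiagonal_of fun _ hf => ⟨E, hE, hf, 1, fun _ _ => by simp⟩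

theorem DeltaTwoNearInfinity.exists_pow_le (hE : IsYoung E) (hfin : IsFiniteValued E)
    (h : DeltaTwoNearInfinity E) (m : ℕ) :
    ∃ (C : ℕ) (B : ℝ≥0∞), B ≠ ∞ ∧ ∀ t, E (2 ^ m * t) ≤ C * E t + B := by
  obtain ⟨C, hC, t₀, ht₀⟩ := h
  obtain ⟨c, hc⟩ := exists_nat_ge C
  have hc0 : (c : ℝ≥0∞) ≠ 0 := by
    have : (0 : ℝ≥0) < c := hC.trans_le hc
    exact_mod_cast this.ne'
  have hstep : ∀ t, (t₀ : ℝ≥0∞) ≤ t → E (2 * t) ≤ c * E t := fun t ht => by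
    induction t with
    | top => simp [hE.map_top, ENNReal.mul_top hc0]
    | coe t => exact (ht₀ t (by exact_mod_cast ht)).trans (by gcongr; exact_mod_cast hc)
  have hpow : ∀ t, (t₀ : ℝ≥0∞) ≤ t → E (2 ^ m * t) ≤ c ^ m * E t := fun t ht => by
    induction m with
    | zero => simp
    | succ m ih =>
      calc E (2 ^ (m + 1) * t) = E (2 * (2 ^ m * t)) := by rw [pow_succ']; ring_nf
        _ ≤ c * E (2 ^ m * t) := hstep _ (ht.trans (le_mul_of_one_le_left zero_le
            (one_le_pow₀ (by norm_num))))
        _ ≤ c * (c ^ m * E t) := by gcongr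
        _ = c ^ (m + 1) * E t := by ring
  refine ⟨c ^ m, E (2 ^ m * t₀), ?_, fun t => ?_⟩
  · have := hfin (2 ^ m * t₀)
    push_cast at this
    exact this.ne
  · push_cast
    rcases le_total (t₀ : ℝ≥0∞) t with ht | ht
    · exact (hpow t ht).trans le_self_add
    · exact (hE.monotone (by gcongr)).trans le_add_self

/-- The Young function is Φ ∘ E with Φ superlinear. On S, Δ₂ bounds E(|g|/ε) by C·E(|g|/2) + B, and
superlinearity bounds C·E by Φ(E)/2 plus a constant. -/
theorem isUniformlySubDiagonal_orliczNorm [IsProbabilityMeasure μ] (hE : IsYoung E)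
    (hfin : IsFiniteValued E) (hdelta : DeltaTwoNearInfinity E) :
    IsUniformlySubDiagonal μ (orliczNorm μ E) := by
  refine isUniformlySubDiagonal_of (fun f hf => ?_) fun A hA hAM => hAM.spaceOf_subset hA ?_
  · obtain ⟨r, hr, -⟩ := ENNReal.lt_iff_exists_nnreal_btwn.1 hf.2
    have hr0 : (r : ℝ≥0∞) ≠ 0 := (zero_le.trans_lt hr).ne'
    have hmod := orliczModular_le_one_of_lt hE hr
    obtain ⟨Φ, hΦ, hΦf, hsuper⟩ := exists_isYoung_superlinear (μ := μ)
      (hE.measurable.comp (hf.1.ereal_abs.div_const (r : ℝ≥0∞)))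
      (ne_top_of_le_ne_top ENNReal.one_ne_top hmod)
    refine ⟨_, hΦ.comp hE, mem_spaceOf_orliczNorm (hΦ.comp hE) hf.1 hr0 (by simp) hΦf,
      almostCompactlyEmbeds_orliczNorm (hΦ.comp hE) fun ε hε hεt => ?_⟩
    obtain ⟨m, hm⟩ : ∃ m : ℕ, 2 / ε ≤ 2 ^ m := by
      obtain ⟨m, hm⟩ := ENNReal.exists_nat_gt (ENNReal.div_ne_top ENNReal.ofNat_ne_top hε :
        2 / ε ≠ ∞)
      exact ⟨m, hm.le.trans (by exact_mod_cast m.lt_two_pow_self.le)⟩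
    obtain ⟨C, B, hB, hCB⟩ := hdelta.exists_pow_le hE hfin m
    obtain ⟨L, hL, hKL⟩ := hsuper (2 * C)
    have hBL : B + L ≠ ∞ := ENNReal.add_ne_top.2 ⟨hB, hL⟩
    -- The modular budget 1 splits evenly: half for Φ(E(|g|/2)), half for the constant B + L on S.
    refine ⟨2⁻¹ / (B + L), by simp [ENNReal.div_pos_iff, hB, hL], fun S hS hSδ g hg hg1 =>
      orliczNorm_le hε hεt ?_⟩
    have hpt : ∀ x, E ((S.indicator g x).abs / ε) ≤
        2⁻¹ * Φ (E ((g x).abs / 2)) + S.indicator (fun _ => B + L) x := fun x => by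
      by_cases hx : x ∈ S
      · simp only [indicator_of_mem hx]
        have h1 : (g x).abs / ε ≤ 2 ^ m * ((g x).abs / 2) := by
          calc (g x).abs / ε = 2 / ε * ((g x).abs / 2) := by
                rw [mul_comm, ← mul_div_assoc, ENNReal.div_mul_cancel (by simp) (by simp)]
            _ ≤ _ := by gcongr
        have h2 : (C : ℝ≥0∞) * E ((g x).abs / 2) ≤ 2⁻¹ * Φ (E ((g x).abs / 2)) + L := by
          calc (C : ℝ≥0∞) * E ((g x).abs / 2)
              = 2⁻¹ * ((2 * C : ℕ) * E ((g x).abs / 2)) := by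
                push_cast
                rw [← mul_assoc, ← mul_assoc, ENNReal.inv_mul_cancel (by simp) (by simp), one_mul]
            _ ≤ 2⁻¹ * (Φ (E ((g x).abs / 2)) + L) := mul_le_mul_right (hKL _) _
            _ = 2⁻¹ * Φ (E ((g x).abs / 2)) + 2⁻¹ * L := mul_add _ _ _
            _ ≤ _ := add_le_add le_rfl (mul_le_of_le_one_left zero_le (by simp))
        calc E ((g x).abs / ε) ≤ E (2 ^ m * ((g x).abs / 2)) := hE.monotone h1
          _ ≤ C * E ((g x).abs / 2) + B := hCB _
          _ ≤ 2⁻¹ * Φ (E ((g x).abs / 2)) + L + B := add_le_add h2 le_rfl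
          _ = _ := by ring
      · simp [hx, hE.map_zero]
    calc orliczModular μ E (S.indicator g) ε
        ≤ ∫⁻ x, 2⁻¹ * Φ (E ((g x).abs / 2)) + S.indicator (fun _ => B + L) x ∂μ :=
          lintegral_mono hpt
      _ = 2⁻¹ * orliczModular μ (fun t => Φ (E t)) g 2 + (B + L) * μ S := by
          rw [lintegral_add_right _ (measurable_const.indicator hS),
            lintegral_indicator_const hS, lintegral_const_mul' _ _ (by simp)]
          rfl
      _ ≤ 2⁻¹ * 1 + (B + L) * (2⁻¹ / (B + L)) := by gcongr
      _ ≤ 2⁻¹ * 1 + 2⁻¹ := by gcongr; exact ENNReal.mul_div_le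
      _ = 1 := by rw [mul_one, ENNReal.inv_two_add_inv_two]
  · intro f g hf hg s n hs hfg hgfin
    obtain ⟨r, hr, -⟩ := ENNReal.lt_iff_exists_nnreal_btwn.1 hgfin
    have hr0 : (r : ℝ≥0∞) ≠ 0 := (zero_le.trans_lt hr).ne'
    have hs0 : (s : ℝ≥0∞) ≠ 0 := by exact_mod_cast hs.ne'
    have hmod := orliczModular_le_one_of_lt hE hr
    have hsr0 : (s : ℝ≥0∞) * r ≠ 0 := mul_ne_zero hs0 hr0
    have hsrt : (s : ℝ≥0∞) * r ≠ ∞ := ENNReal.mul_ne_top (by simp) (by simp)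
    refine (mem_spaceOf_orliczNorm hE hf hsr0 hsrt ?_).2
    have hpt : ∀ x, E ((f x).abs / (s * r)) ≤ E (n / (s * r)) + E ((g x).abs / r) := fun x => by
      rcases le_or_gt (f x).abs n with h | h
      · exact (hE.monotone (by gcongr)).trans le_self_add
      · refine (hE.monotone ?_).trans le_add_self
        calc (f x).abs / (s * r) ≤ s * (g x).abs / (s * r) := by gcongr; exact hfg x h
          _ = (g x).abs / r := ENNReal.mul_div_mul_left _ _ hs0 (by simp)
    refine ne_top_of_le_ne_top ?_ (lintegral_mono hpt)
    rw [lintegral_add_left measurable_const, lintegral_const, measure_univ, mul_one]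
    refine ENNReal.add_ne_top.2 ⟨?_, ne_top_of_le_ne_top ENNReal.one_ne_top hmod⟩
    have hd : (n : ℝ≥0∞) / (s * r) ≠ ∞ := ENNReal.div_ne_top (by simp) hsr0
    have := hfin ((n : ℝ≥0∞) / (s * r)).toNNReal
    rw [ENNReal.coe_toNNReal hd] at this
    exact this.ne

/-- Uniform sub-diagonality makes the norm of each f absolutely continuous: f lies in some almost
compactly embedded `L^A`, and scaling puts it in the unit ball. Both necessary conditions follow
from this. -/
theorem IsUniformlySubDiagonal.exists_orliczModular_le (hE : IsYoung E)
    (h : IsUniformlySubDiagonal μ (orliczNorm μ E)) {f : α → EReal}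
    (hf : f ∈ spaceOf (orliczNorm μ E)) {S : ℕ → Set α} (hS : ∀ n, MeasurableSet (S n))
    (hlim : ∀ᵐ x ∂μ, ∀ᶠ n in atTop, x ∉ S n) {ε : ℝ≥0∞} (hε : ε ≠ 0) :
    ∃ n, orliczModular μ E ((S n).indicator f) ε ≤ 1 := by
  obtain ⟨A, hA, hACE, hfA, -⟩ := h.exists_subset hf
  obtain ⟨r, hr, -⟩ := ENNReal.lt_iff_exists_nnreal_btwn.1 hfA.2
  have hr0 : (r : ℝ≥0∞) ≠ 0 := (zero_le.trans_lt hr).ne'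
  have hmod := orliczModular_le_one_of_lt hA hr
  set g : α → EReal := fun x => (((f x).abs / r : ℝ≥0∞) : EReal) with hg
  have hgm : Measurable g := (hf.1.ereal_abs.div_const _).coe_ereal_ennreal
  have hgabs : ∀ x, (g x).abs = (f x).abs / r := fun x => EReal.abs_coe_ennreal _
  have hNg : orliczNorm μ A g ≤ 1 := orliczNorm_le one_ne_zero ENNReal.one_ne_top (by
    simpa [orliczModular, hgabs] using hmod)
  have ht := hACE S hS (by
    filter_upwards [hlim] with x hx
    refine tendsto_const_nhds.congr' ?_
    filter_upwards [hx] with n hn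
    rw [indicator_of_notMem hn])
  obtain ⟨n, hn⟩ := (ht.eventually_lt_const (u := ε / r) (ENNReal.div_pos hε (by simp))).exists
  refine ⟨n, ?_⟩
  have hMn := (le_iSup₂_of_le (f := fun f (_ : f ∈ {f ∈ spaceOf (orliczNorm μ A) |
    orliczNorm μ A f ≤ 1}) => orliczNorm μ E ((S n).indicator f)) g
      ⟨⟨hgm, hNg.trans_lt ENNReal.one_lt_top⟩, hNg⟩ le_rfl).trans_lt hn
  have := orliczModular_le_one_of_lt hE hMn
  refine le_trans (le_of_eq (lintegral_congr fun x => ?_)) this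
  by_cases hx : x ∈ S n
  · rw [indicator_of_mem hx, indicator_of_mem hx, hgabs, div_eq_mul_inv (_ / _) (ε / _),
      ENNReal.inv_div (Or.inl (by simp)) (Or.inl hr0), ← mul_div_assoc,
      ENNReal.div_mul_cancel hr0 (by simp)]
  · simp [hx]

end Orlicz

instance : IsProbabilityMeasure unitMeasure := ⟨by simp [unitMeasure]⟩

/-! ### Step functions with prescribed distribution -/

section StepFunctions

/-- Every sequence of heights `t k`, weighted by `2⁻¹ ^ (k + 1) * m k`, is the distribution of a
measurable function on `(0,1)`. -/
theorem exists_measurable_forall_lintegral_eq_tsum (t : ℕ → ℝ≥0∞) {m : ℕ → ℝ≥0∞}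
    (hm : ∀ k, m k ≤ 1) :
    ∃ g : ℝ → ℝ≥0∞, Measurable g ∧ ∀ Ψ : ℝ≥0∞ → ℝ≥0∞, Ψ 0 = 0 →
      ∫⁻ x, Ψ (g x) ∂unitMeasure = ∑' k, Ψ (t k) * (2⁻¹ ^ (k + 1) * m k) := by
  -- Because m_k ≤ 1, each interval stays inside its own dyadic block (2^{-k-1}, 2^{-k}), which
  -- gives disjointness.
  set I : ℕ → Set ℝ := fun k => Ioo (2⁻¹ ^ (k + 1)) (2⁻¹ ^ (k + 1) * (1 + (m k).toReal)) with hI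
  have hm' : ∀ k, (m k).toReal ≤ 1 := fun k => by
    simpa using ENNReal.toReal_mono ENNReal.one_ne_top (hm k)
  have hsub : ∀ k, I k ⊆ Ioo (2⁻¹ ^ (k + 1)) (2⁻¹ ^ k) := fun k =>
    Ioo_subset_Ioo_right (by
      have : (0 : ℝ) < 2⁻¹ ^ k := by positivity
      rw [pow_succ]; nlinarith [hm' k])
  have hanti : ∀ {i j : ℕ}, i ≤ j → (2⁻¹ : ℝ) ^ j ≤ 2⁻¹ ^ i := fun h =>
    pow_le_pow_of_le_one (by norm_num) (by norm_num) h
  have hdisj : ∀ {i j x}, x ∈ I i → x ∈ I j → i = j := by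
    have : ∀ {i j x}, x ∈ I i → x ∈ I j → ¬ i < j := fun {i j x} hi hj hij =>
      absurd ((hsub i hi).1.trans (hsub j hj).2) (hanti (Nat.succ_le_of_lt hij)).not_gt
    intro i j x hi hj
    exact le_antisymm (not_lt.1 (this hj hi)) (not_lt.1 (this hi hj))
  have hmeas : ∀ k, MeasurableSet (I k) := fun k => measurableSet_Ioo
  have hvol : ∀ k, unitMeasure (I k) = 2⁻¹ ^ (k + 1) * m k := fun k => by
    have h01 : I k ⊆ Ioo 0 1 := (hsub k).trans
      (Ioo_subset_Ioo (by positivity) (by simpa using hanti (Nat.zero_le k)))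
    rw [unitMeasure, Measure.restrict_apply (hmeas k), inter_eq_left.2 h01, Real.volume_Ioo,
      mul_add, mul_one, add_sub_cancel_left, ENNReal.ofReal_mul (by positivity),
      ENNReal.ofReal_toReal (ne_top_of_le_ne_top ENNReal.one_ne_top (hm k)),
      ENNReal.ofReal_pow (by positivity), ENNReal.ofReal_inv_of_pos (by norm_num)]
    simp
  refine ⟨fun x => ∑' k, (I k).indicator (fun _ => t k) x,
    Measurable.tsum fun k => measurable_const.indicator (hmeas k), fun Ψ hΨ => ?_⟩
  have hpt : ∀ x, Ψ (∑' k, (I k).indicator (fun _ => t k) x) =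
      ∑' k, (I k).indicator (fun _ => Ψ (t k)) x := fun x => by
    by_cases hx : ∃ k, x ∈ I k
    · obtain ⟨k, hk⟩ := hx
      have hne : ∀ j ≠ k, x ∉ I j := fun j hj h => hj (hdisj h hk)
      rw [tsum_eq_single k fun j hj => indicator_of_notMem (hne j hj) _,
        tsum_eq_single k fun j hj => indicator_of_notMem (hne j hj) _, indicator_of_mem hk,
        indicator_of_mem hk]
    · push Not at hx
      simp [hx, hΨ]
  simp_rw [hpt]
  rw [lintegral_tsum fun k => (measurable_const.indicator (hmeas k)).aemeasurable]
  exact tsum_congr fun k => by rw [lintegral_indicator_const (hmeas k), hvol]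

theorem tsum_inv_two_pow_succ : ∑' k : ℕ, (2⁻¹ : ℝ≥0∞) ^ (k + 1) = 1 := by
  simp_rw [pow_succ]
  rw [ENNReal.tsum_mul_right, ENNReal.tsum_geometric, ENNReal.one_sub_inv_two, inv_inv,
    ENNReal.mul_inv_cancel (by simp) (by simp)]

end StepFunctions

/-! ### Orlicz spaces: necessity of finiteness and Δ₂ -/

section OrliczNecessity

variable {E : ℝ≥0∞ → ℝ≥0∞}

theorem const_mem_spaceOf {α : Type*} [MeasurableSpace α] {μ : Measure α}
    [IsProbabilityMeasure μ] (hE : IsYoung E) :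
    (fun _ => 1 : α → EReal) ∈ spaceOf (orliczNorm μ E) := by
  obtain ⟨t, ht0, htt, ht⟩ := hE.exists_lt one_ne_zero
  refine mem_spaceOf_orliczNorm hE measurable_const (s := t⁻¹) (by simpa)
    (by simpa using ht0.ne') ?_
  have h1 : (1 : EReal).abs = 1 := by simpa using EReal.abs_coe_ennreal 1
  simpa [orliczModular, h1] using (ht.trans ENNReal.one_lt_top).ne

theorem IsUniformlySubDiagonal.isFiniteValued (hE : IsYoung E)
    (h : IsUniformlySubDiagonal unitMeasure (orliczNorm unitMeasure E)) : IsFiniteValued E := by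
  intro T
  by_contra hT
  rw [not_lt_top_iff] at hT
  have h1 : (1 : EReal).abs = 1 := by simpa using EReal.abs_coe_ennreal 1
  obtain ⟨n, hn⟩ := h.exists_orliczModular_le hE (const_mem_spaceOf hE)
    (S := fun n : ℕ => Ioo (0 : ℝ) (1 / (n + 1))) (fun n => measurableSet_Ioo)
    (ae_of_all _ fun x => by
      rcases le_or_gt x 0 with hx | hx
      · exact Eventually.of_forall fun n h => absurd h.1 hx.not_gt
      · filter_upwards [tendsto_one_div_add_atTop_nhds_zero_nat.eventually_lt_const hx] with n hn h
        exact absurd h.2 hn.not_gt)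
    -- At scale 1/T the constant 1 becomes T, where E is infinite, so every set of positive measure
    -- has infinite modular.
    (ε := (T : ℝ≥0∞)⁻¹) (by simp)
  refine absurd hn (not_le.2 ?_)
  have hle : (1 : ℝ) / (n + 1) ≤ 1 := by
    rw [div_le_one (by positivity)]
    have : (0 : ℝ) ≤ n := Nat.cast_nonneg n
    linarith
  have hvol : unitMeasure (Ioo (0 : ℝ) (1 / (n + 1))) ≠ 0 := by
    rw [unitMeasure, Measure.restrict_apply measurableSet_Ioo,
      inter_eq_left.2 (Ioo_subset_Ioo_right hle), Real.volume_Ioo, sub_zero]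
    simp only [ne_eq, ENNReal.ofReal_eq_zero, not_le]
    positivity
  calc (1 : ℝ≥0∞) < ∞ := ENNReal.one_lt_top
    _ = ∞ * unitMeasure (Ioo (0 : ℝ) (1 / (n + 1))) := (ENNReal.top_mul hvol).symm
    _ = ∫⁻ x, (Ioo (0 : ℝ) (1 / (n + 1))).indicator (fun _ => ∞) x ∂unitMeasure :=
      (lintegral_indicator_const measurableSet_Ioo _).symm
    _ ≤ _ := lintegral_mono fun x => by
      by_cases hx : x ∈ Ioo (0 : ℝ) (1 / (n + 1))
      · rw [indicator_of_mem hx, indicator_of_mem hx, h1]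
        simp [hT]
      · rw [indicator_of_notMem hx]; exact zero_le

/-- A gliding-hump source of counterexamples: height t_k on a set of measure 2^{-k-1}/E(t_k) has
modular 2^{-k-1}, whatever property R is demanded of arbitrarily large heights. Taking E(t_k) ≥ 1
makes the sets fit into (0,1). -/
theorem exists_measurable_lintegral_eq_one (hE : IsYoung E)
    (R : ℕ → ℝ≥0 → Prop) (hR : ∀ k, ∀ t₀ : ℝ≥0, ∃ t ≥ t₀, E t ≠ ∞ ∧ R k t) :
    ∃ (t : ℕ → ℝ≥0) (g : ℝ → ℝ≥0∞), (∀ k, R k (t k) ∧ E (t k) ≠ 0 ∧ E (t k) ≠ ∞ ∧ 0 < t k) ∧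
      Measurable g ∧ ∫⁻ x, E (g x) ∂unitMeasure = 1 ∧
      ∀ Ψ : ℝ≥0∞ → ℝ≥0∞, Ψ 0 = 0 →
        ∫⁻ x, Ψ (g x) ∂unitMeasure = ∑' k, Ψ (t k) * (2⁻¹ ^ (k + 1) * (E (t k))⁻¹) := by
  obtain ⟨t₁, ht₁0, ht₁⟩ := hE.exists_gt ENNReal.one_ne_top
  choose t ht htt htR using fun k => hR k t₁
  have h1 : ∀ k, 1 ≤ E (t k) := fun k => ht₁.le.trans (hE.monotone (by exact_mod_cast ht k))
  have h0 : ∀ k, E (t k) ≠ 0 := fun k => (zero_lt_one.trans_le (h1 k)).ne'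
  obtain ⟨g, hg, hgΨ⟩ := exists_measurable_forall_lintegral_eq_tsum (fun k => (t k : ℝ≥0∞))
    (m := fun k => (E (t k))⁻¹) (fun k => ENNReal.inv_le_one.2 (h1 k))
  refine ⟨t, g, fun k => ⟨htR k, h0 k, htt k, ht₁0.trans_le (ht k)⟩, hg, ?_, hgΨ⟩
  rw [hgΨ E hE.map_zero, ← tsum_inv_two_pow_succ]
  exact tsum_congr fun k => by
    rw [mul_left_comm, ENNReal.mul_inv_cancel (h0 k) (htt k), mul_one]

theorem mem_spaceOf_of_lintegral_eq_one (hE : IsYoung E) {α : Type*} [MeasurableSpace α]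
    {μ : Measure α} {g : α → ℝ≥0∞} (hg : Measurable g) (h : ∫⁻ x, E (g x) ∂μ = 1) :
    (fun x => (g x : EReal)) ∈ spaceOf (orliczNorm μ E) :=
  mem_spaceOf_orliczNorm hE hg.coe_ereal_ennreal one_ne_zero ENNReal.one_ne_top (by
    simp [orliczModular, h])

/-- If Δ₂ fails, heights with E(2t_k) > 2^{k+1}E(t_k) give ∫ E(g) = 1 but ∫ E(2g) = ∞. A tail with
modular at most 1 at scale 1/2 together with the bounded part, at most E(2n), contradicts this. -/
theorem IsUniformlySubDiagonal.deltaTwoNearInfinity (hE : IsYoung E)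
    (h : IsUniformlySubDiagonal unitMeasure (orliczNorm unitMeasure E)) :
    DeltaTwoNearInfinity E := by
  have hfin := h.isFiniteValued hE
  by_contra hcon
  unfold DeltaTwoNearInfinity at hcon
  push Not at hcon
  obtain ⟨t, g, ht, hg, hEg, hgΨ⟩ := exists_measurable_lintegral_eq_one hE
    (fun k t => 2 ^ (k + 1) * E t < E (2 * t)) (fun k t₀ => by
      obtain ⟨t, ht, hCt⟩ := hcon (2 ^ (k + 1)) (by positivity) t₀
      exact ⟨t, ht, (hfin t).ne, by simpa using hCt⟩)
  have hgfin : ∀ᵐ x ∂unitMeasure, g x < ∞ := by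
    filter_upwards [ae_lt_top (hE.measurable.comp hg) (by simp [hEg])] with x hx
    by_contra hc
    rw [Function.comp, not_lt_top_iff.1 hc, hE.map_top] at hx
    exact lt_irrefl _ hx
  have hS : ∀ n : ℕ, MeasurableSet {x | (n : ℝ≥0∞) < g x} := fun n =>
    measurableSet_lt measurable_const hg
  obtain ⟨n, hn⟩ := h.exists_orliczModular_le hE (mem_spaceOf_of_lintegral_eq_one hE hg hEg)
    hS (by
      filter_upwards [hgfin] with x hx
      obtain ⟨N, hN⟩ := ENNReal.exists_nat_gt hx.ne
      filter_upwards [eventually_ge_atTop N] with n hn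
      exact not_lt.2 (hN.le.trans (by exact_mod_cast hn))) (ε := 2⁻¹) (by simp)
  have htop : ∫⁻ x, E (2 * g x) ∂unitMeasure = ∞ := by
    rw [hgΨ (fun y => E (2 * y)) (by simp [hE.map_zero])]
    refine top_le_iff.1 ?_
    calc ∞ = ∑' _ : ℕ, (1 : ℝ≥0∞) := (ENNReal.tsum_const_eq_top_of_ne_zero one_ne_zero).symm
      _ ≤ _ := ENNReal.tsum_le_tsum fun k => by
        calc (1 : ℝ≥0∞) = 2 ^ (k + 1) * E (t k) * (2⁻¹ ^ (k + 1) * (E (t k))⁻¹) := by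
              rw [mul_mul_mul_comm, ← mul_pow, ENNReal.mul_inv_cancel (by simp) (by simp),
                ENNReal.mul_inv_cancel (ht k).2.1 (ht k).2.2.1, one_pow, one_mul]
          _ ≤ _ := mul_le_mul_left (ht k).1.le _
  refine absurd htop (ne_top_of_le_ne_top ?_ (lintegral_mono (g := fun x => E (2 * n) +
    E (({x | (n : ℝ≥0∞) < g x}.indicator (fun x => (g x : EReal)) x).abs / 2⁻¹)) fun x => ?_))
  · rw [lintegral_add_left measurable_const, lintegral_const, measure_univ, mul_one]
    have := hfin (2 * n)
    push_cast at this
    exact ENNReal.add_ne_top.2 ⟨this.ne, ne_top_of_le_ne_top ENNReal.one_ne_top hn⟩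
  · by_cases hx : (n : ℝ≥0∞) < g x
    · refine le_add_left (le_of_eq ?_)
      rw [indicator_of_mem (by exact hx), EReal.abs_coe_ennreal, div_eq_mul_inv, inv_inv, mul_comm]
    · exact (hE.monotone (by gcongr; exact not_lt.1 hx)).trans le_self_add

theorem isUniformlySubDiagonal_orliczNorm_iff (hE : IsYoung E) :
    IsUniformlySubDiagonal unitMeasure (orliczNorm unitMeasure E) ↔
      IsFiniteValued E ∧ DeltaTwoNearInfinity E :=
  ⟨fun h => ⟨h.isFiniteValued hE, h.deltaTwoNearInfinity hE⟩,
    fun h => isUniformlySubDiagonal_orliczNorm hE h.1 h.2⟩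

end OrliczNecessity

/-! ### Lebesgue spaces as Orlicz spaces -/

section Lebesgue

variable {α : Type*} [MeasurableSpace α] {μ : Measure α}

theorem lebesgueNorm_eq_orliczNorm_rpow {q : ℝ≥0∞} (hq : q ≠ 0) (hqt : q ≠ ∞) :
    lebesgueNorm μ q = orliczNorm μ (fun t => t ^ q.toReal) := by
  ext f
  have hq0 : 0 < q.toReal := ENNReal.toReal_pos hq hqt
  set N := ∫⁻ x, (f x).abs ^ q.toReal ∂μ
  have hN : lebesgueNorm μ q f = N ^ (1 / q.toReal) := by
    rw [lebesgueNorm, eLpNorm_eq_lintegral_rpow_enorm_toReal hq hqt]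
    simp [N]
  have hmod : ∀ s, s ≠ 0 → s ≠ ∞ →
      (orliczModular μ (fun t => t ^ q.toReal) f s ≤ 1 ↔ lebesgueNorm μ q f ≤ s) := by
    intro s hs hst
    have h1 : orliczModular μ (fun t => t ^ q.toReal) f s = N / s ^ q.toReal := by
      unfold orliczModular
      simp_rw [div_eq_mul_inv]
      rw [← lintegral_mul_const' _ _ (by simp [hs, hq0, hst])]
      refine lintegral_congr fun x => ?_
      rw [ENNReal.mul_rpow_of_nonneg _ _ hq0.le, ENNReal.inv_rpow]
    rw [h1, hN, one_div, ENNReal.rpow_inv_le_iff hq0, ENNReal.div_le_iff (by simp [hs, hst, hq0])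
      (by simp [hst, hs, hq0]), one_mul]
  refine le_antisymm (le_sInf fun s hs => (hmod s hs.1.ne' hs.2.1.ne).1 hs.2.2) ?_
  refine le_of_forall_gt fun r hr => ?_
  obtain ⟨s, hs, hsr⟩ := exists_between hr
  have hs0 : s ≠ 0 := (zero_le.trans_lt hs).ne'
  have hst : s ≠ ∞ := (hsr.trans_le le_top).ne
  exact (orliczNorm_le hs0 hst ((hmod s hs0 hst).2 hs.le)).trans_lt hsr

theorem lebesgueNorm_top_eq_orliczNorm {f : α → EReal} (hf : Measurable f) :
    lebesgueNorm μ ∞ f = orliczNorm μ linftyYoung f := by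
  have hN : lebesgueNorm μ ∞ f = essSup (fun x => (f x).abs) μ := by
    simp [lebesgueNorm, eLpNormEssSup]
  have hdiv : ∀ {s : ℝ≥0∞}, s ≠ 0 → s ≠ ∞ → ∀ x, linftyYoung ((f x).abs / s) =
      {x | s < (f x).abs}.indicator (fun _ => ∞) x := fun {s} hs hst x => by
    have : (f x).abs / s ≤ 1 ↔ ¬ s < (f x).abs := by
      rw [ENNReal.div_le_iff hs hst, one_mul, not_lt]
    by_cases h : s < (f x).abs <;> simp [linftyYoung, this, indicator, h]
  refine le_antisymm (le_sInf fun s ⟨hs0, hst, hs⟩ => ?_) ?_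
  · rw [hN]
    refine essSup_le_of_ae_le _ ?_
    have hm : Measurable fun x => linftyYoung ((f x).abs / s) :=
      isYoung_linftyYoung.measurable.comp (hf.ereal_abs.div_const s)
    filter_upwards [ae_lt_top hm (ne_top_of_le_ne_top ENNReal.one_ne_top hs)] with x hx
    by_contra hc
    rw [hdiv hs0.ne' hst.ne, indicator_of_mem (by exact not_le.1 hc)] at hx
    exact lt_irrefl _ hx
  · refine le_of_forall_gt fun r hr => ?_
    obtain ⟨s, hs, hsr⟩ := exists_between hr
    have hs0 : s ≠ 0 := (zero_le.trans_lt hs).ne'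
    have hst : s ≠ ∞ := (hsr.trans_le le_top).ne
    refine (orliczNorm_le hs0 hst ?_).trans_lt hsr
    unfold orliczModular
    simp_rw [hdiv hs0 hst]
    rw [lintegral_congr_ae (g := fun _ => 0)]
    · simp
    · rw [hN] at hs
      filter_upwards [ae_lt_of_essSup_lt hs] with x hx
      simp [hx.le]

theorem isSubDiagonal_lebesgueNorm {q : ℝ≥0∞} (hq : 1 ≤ q) :
    IsSubDiagonal μ (lebesgueNorm μ q) := by
  rcases eq_or_ne q ∞ with rfl | hqt
  · exact (isSubDiagonal_congr fun f hf => lebesgueNorm_top_eq_orliczNorm hf).2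
      (isSubDiagonal_orliczNorm isYoung_linftyYoung)
  · rw [lebesgueNorm_eq_orliczNorm_rpow (zero_lt_one.trans_le hq).ne' hqt]
    exact isSubDiagonal_orliczNorm (IsYoung.rpow (by simpa using ENNReal.toReal_mono hqt hq))

theorem isUniformlySubDiagonal_lebesgueNorm_iff {q : ℝ≥0∞} (hq : 1 ≤ q) :
    IsUniformlySubDiagonal unitMeasure (lebesgueNorm unitMeasure q) ↔ q < ∞ := by
  rcases eq_or_ne q ∞ with rfl | hqt
  · rw [isUniformlySubDiagonal_congr fun f hf => lebesgueNorm_top_eq_orliczNorm hf,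
      isUniformlySubDiagonal_orliczNorm_iff isYoung_linftyYoung]
    simp only [lt_irrefl, iff_false]
    intro h
    have := h.1 2
    simp [linftyYoung] at this
  · have hq1 : 1 ≤ q.toReal := by simpa using ENNReal.toReal_mono hqt hq
    have hq0 : 0 ≤ q.toReal := by linarith
    rw [lebesgueNorm_eq_orliczNorm_rpow (zero_lt_one.trans_le hq).ne' hqt,
      isUniformlySubDiagonal_orliczNorm_iff (IsYoung.rpow hq1)]
    refine iff_of_true ⟨fun t => ENNReal.rpow_lt_top_of_nonneg hq0 (by simp),
      2 ^ q.toReal, by positivity, 0, fun t _ => ?_⟩ hqt.lt_top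
    dsimp only
    rw [ENNReal.mul_rpow_of_nonneg _ _ hq0, ENNReal.coe_rpow_of_nonneg _ hq0]
    simp

end Lebesgue

/-! ### Classical Lorentz spaces -/

section ClassicalLorentz

variable {w : ℝ → ℝ} {q : ℝ}

theorem isSubDiagonal_classicalLorentzNorm {α : Type*} [MeasurableSpace α] {μ : Measure α}
    [IsProbabilityMeasure μ] (hw_anti : AntitoneOn w (Ioo 0 1))
    (hw_pos : ∀ t ∈ Ioo (0 : ℝ) 1, 0 < w t) (hw_int : IntegrableOn w (Ioo 0 1)) (hq : 1 ≤ q) :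
    IsSubDiagonal μ (classicalLorentzNorm μ q w) := by
  rw [show classicalLorentzNorm μ q w = _ from
    funext (classicalLorentzNorm_eq_layerNorm hw_anti (by linarith))]
  exact isSubDiagonal_layerNorm (isQuasiconcave_primitive_extendWeight hw_anti hw_pos hw_int) hq

theorem isUniformlySubDiagonal_classicalLorentzNorm {α : Type*} [MeasurableSpace α]
    {μ : Measure α} [IsProbabilityMeasure μ] (hw_anti : AntitoneOn w (Ioo 0 1))
    (hw_pos : ∀ t ∈ Ioo (0 : ℝ) 1, 0 < w t) (hw_int : IntegrableOn w (Ioo 0 1)) (hq : 1 ≤ q)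
    {c : ℝ} (hc : 0 < c)
    (h : ∀ t ∈ Ioo (0 : ℝ) 1, c * t ∈ Ioo (0 : ℝ) 1 → 2 * w (c * t) ≤ w t) :
    IsUniformlySubDiagonal μ (classicalLorentzNorm μ q w) := by
  have hc1 : 1 ≤ c := by
    -- For c < 1 monotonicity gives 2w(c/2) ≤ w(1/2) ≤ w(c/2), against positivity.
    by_contra! hc1
    have ht : (1 / 2 : ℝ) ∈ Ioo (0 : ℝ) 1 := by norm_num
    have hct : c * (1 / 2) ∈ Ioo (0 : ℝ) 1 := ⟨by positivity, by linarith⟩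
    have h1 := h _ ht hct
    have h2 := hw_anti hct ht (by linarith)
    linarith [hw_pos _ hct]
  rw [show classicalLorentzNorm μ q w = _ from
    funext (classicalLorentzNorm_eq_layerNorm hw_anti (by linarith))]
  refine isUniformlySubDiagonal_layerNorm
    (isQuasiconcave_primitive_extendWeight hw_anti hw_pos hw_int) hq
    (fun ε hε => exists_primitive_le (primitive_extendWeight_one_ne_top hw_int) hε)
    (K := ENNReal.ofReal c) (d := 1) (by simpa using hc1) (by simp) (by simp)
    fun t _ => primitive_doubling hc (fun r hr => ?_) t
  rcases lt_or_ge (c * r) 1 with h1 | h1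
  · have hcr : c * r ∈ Ioo (0 : ℝ) 1 := ⟨by positivity, h1⟩
    have hr' : r ∈ Ioo (0 : ℝ) 1 := ⟨hr, lt_of_le_of_lt (le_mul_of_one_le_left hr.le hc1) h1⟩
    rw [extendWeight_of_mem hcr, extendWeight_of_mem hr']
    calc 2 * ENNReal.ofReal (w (c * r)) = ENNReal.ofReal (2 * w (c * r)) := by
          rw [ENNReal.ofReal_mul (by norm_num)]; simp
      _ ≤ _ := ENNReal.ofReal_le_ofReal (h r hr' hcr)
  · rw [extendWeight_of_one_le h1]; simp

end ClassicalLorentz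

/-! ### Lorentz spaces with q ≤ p -/

section LorentzSufficiency

variable {p q : ℝ≥0∞}

theorem lorentzNorm_eq_classicalLorentzNorm {α : Type*} [MeasurableSpace α] (μ : Measure α)
    (hq : q ≠ ∞) :
    lorentzNorm μ p q =
      classicalLorentzNorm μ q.toReal fun t => t ^ (q.toReal / p.toReal - 1) := by
  ext f
  rw [lorentzNorm, if_neg hq, classicalLorentzNorm]
  congr 1
  refine setLIntegral_congr_fun measurableSet_Ioi fun t ht => ?_
  have ht' : (0 : ℝ) < t := ht
  rw [ENNReal.mul_rpow_of_nonneg _ _ ENNReal.toReal_nonneg, ← ENNReal.rpow_mul,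
    ENNReal.ofReal_rpow_of_pos ht', mul_comm, mul_div_assoc, ← ENNReal.ofReal_div_of_pos ht',
    Real.rpow_sub_one ht'.ne', one_div_mul_eq_div]

theorem lorentzNorm_self_eq_lebesgueNorm {α : Type*} [MeasurableSpace α] {μ : Measure α}
    [IsProbabilityMeasure μ] (hp : p ≠ 0) (hpt : p ≠ ∞) {f : α → EReal} (hf : Measurable f) :
    lorentzNorm μ p p f = lebesgueNorm μ p f := by
  have hp0 : 0 < p.toReal := ENNReal.toReal_pos hp hpt
  have hw : (fun t : ℝ => t ^ (p.toReal / p.toReal - 1)) = fun _ => (1 : ℝ) := by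
    ext t
    rw [div_self hp0.ne', sub_self, Real.rpow_zero]
  have hprim : ∀ d ≤ 1, primitive (extendWeight fun _ => (1 : ℝ)) d = d := fun d hd => by
    refine Eq.trans ?_ ((primitive_const 1 d).trans (one_mul d))
    refine setLIntegral_congr_fun measurableSet_Ioi fun s hs => ?_
    by_cases h : ENNReal.ofReal s < d
    · have h1 : s < 1 := ENNReal.ofReal_lt_one.1 (h.trans_le hd)
      simp [indicator, h, extendWeight_of_mem (w := fun _ => 1) ⟨hs, h1⟩]
    · simp [indicator, h]
  rw [lorentzNorm_eq_classicalLorentzNorm μ hpt, hw,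
    classicalLorentzNorm_eq_layerNorm antitoneOn_const hp0, layerNorm, layerIntegral,
    lebesgueNorm, eLpNorm_eq_lintegral_rpow_enorm_toReal hp hpt]
  congr 1
  have := lintegral_primitive (μ := μ) (a := fun _ => 1) measurable_const
    (hf.ereal_abs.pow_const p.toReal)
  simp only [primitive_const, one_mul] at this
  simp only [enorm_eq_self, this]
  exact lintegral_congr fun s => hprim _ prob_le_one

theorem isUniformlySubDiagonal_lorentzNorm (hp : 1 ≤ p) (hpt : p ≠ ∞) (hq : 1 ≤ q)
    (hqp : q ≤ p) :
    IsSubDiagonal unitMeasure (lorentzNorm unitMeasure p q) ∧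
      IsUniformlySubDiagonal unitMeasure (lorentzNorm unitMeasure p q) := by
  have hqt : q ≠ ∞ := ne_top_of_le_ne_top hpt hqp
  -- For q = p the weight is constant and its halving condition fails, so this case goes through
  -- `L^p`.
  rcases hqp.eq_or_lt with rfl | hlt
  · have hcongr : ∀ f, Measurable f →
        lorentzNorm unitMeasure q q f = lebesgueNorm unitMeasure q f := fun f hf =>
      lorentzNorm_self_eq_lebesgueNorm (zero_lt_one.trans_le hp).ne' hpt hf
    rw [isSubDiagonal_congr hcongr, isUniformlySubDiagonal_congr hcongr]
    exact ⟨isSubDiagonal_lebesgueNorm hp,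
      (isUniformlySubDiagonal_lebesgueNorm_iff hp).2 hpt.lt_top⟩
  have hq1 : 1 ≤ q.toReal := by simpa using ENNReal.toReal_mono hqt hq
  have hlt' : q.toReal < p.toReal := ENNReal.toReal_strict_mono hpt hlt
  have hp0 : 0 < p.toReal := by linarith
  set e := q.toReal / p.toReal - 1 with he
  have he0 : e < 0 := by rw [he, sub_neg, div_lt_one hp0]; exact hlt'
  have he1 : -1 < e := by
    have : 0 < q.toReal / p.toReal := by positivity
    linarith
  have hanti : AntitoneOn (fun t : ℝ => t ^ e) (Ioo 0 1) := fun s hs t _ hst =>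
    Real.rpow_le_rpow_of_nonpos hs.1 hst he0.le
  have hpos : ∀ t ∈ Ioo (0 : ℝ) 1, 0 < t ^ e := fun t ht => Real.rpow_pos_of_pos ht.1 e
  have hint : IntegrableOn (fun t : ℝ => t ^ e) (Ioo 0 1) :=
    (intervalIntegral.integrableOn_Ioo_rpow_iff one_pos).2 he1
  rw [lorentzNorm_eq_classicalLorentzNorm _ hqt]
  refine ⟨isSubDiagonal_classicalLorentzNorm hanti hpos hint hq1,
    -- Chosen so that c^e = 1/2.
    isUniformlySubDiagonal_classicalLorentzNorm hanti hpos hint hq1 (c := (2⁻¹ : ℝ) ^ e⁻¹)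
      (by positivity) fun t ht _ => ?_⟩
  rw [Real.mul_rpow (by positivity) ht.1.le, ← Real.rpow_mul (by norm_num),
    inv_mul_cancel₀ he0.ne, Real.rpow_one, ← mul_assoc]
  simp

end LorentzSufficiency

/-! ### Lorentz spaces with p < q -/

section LorentzNecessity

variable {p q : ℝ≥0∞}

/-- The weak-type bound `L^{p,q}` ⊂ `L^{p,∞}` with a crude constant: f^* ≥ v up to a = |{|f| > v}|,
and (a/2, a) has dt/t-measure at least 1/2. -/
theorem le_lorentzNorm {α : Type*} [MeasurableSpace α] {μ : Measure α} [IsFiniteMeasure μ]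
    (hp : 1 ≤ p) (hpt : p ≠ ∞) (hq : 1 ≤ q) (f : α → EReal) (v : ℝ≥0∞) :
    2⁻¹ * ((2⁻¹ * distrib μ f v) ^ (1 / p.toReal) * v) ≤ lorentzNorm μ p q f := by
  have hp0 : 0 < p.toReal := ENNReal.toReal_pos (zero_lt_one.trans_le hp).ne' hpt
  have hp1 : 0 < 1 / p.toReal := by positivity
  have hDt : distrib μ f v ≠ ∞ := measure_ne_top _ _
  rcases eq_or_ne (distrib μ f v) 0 with hD | hD
  · simp [hD, hp0]
  set a := (distrib μ f v).toReal with ha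
  have ha0 : 0 < a := ENNReal.toReal_pos hD hDt
  have haD : ENNReal.ofReal a = distrib μ f v := ENNReal.ofReal_toReal hDt
  have ha2 : ENNReal.ofReal (a / 2) = 2⁻¹ * distrib μ f v := by
    rw [ENNReal.ofReal_div_of_pos (by norm_num), haD, div_eq_mul_inv, mul_comm]; simp
  have hrearr : ∀ t < a, v ≤ rearr μ f (ENNReal.ofReal t) := fun t ht =>
    (lt_rearr_iff.2 (by rw [← haD]; exact (ENNReal.ofReal_lt_ofReal_iff ha0).2 ht)).le
  set X := (2⁻¹ * distrib μ f v) ^ (1 / p.toReal) * v with hX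
  have hbound : ∀ t ∈ Ico (a / 2) a,
      X ≤ ENNReal.ofReal t ^ (1 / p.toReal) * rearr μ f (ENNReal.ofReal t) := fun t ht => by
    rw [hX, ← ha2]
    exact mul_le_mul' (ENNReal.rpow_le_rpow (ENNReal.ofReal_le_ofReal ht.1) hp1.le)
      (hrearr t ht.2)
  unfold lorentzNorm
  split_ifs with hqt
  · refine (mul_le_of_le_one_left zero_le (by simp)).trans ?_
    exact le_iSup₂_of_le (a / 2) (mem_Ioi.2 (by positivity))
      (hbound (a / 2) ⟨le_rfl, by linarith⟩)
  · have hq1 : 1 ≤ q.toReal := by simpa using ENNReal.toReal_mono hqt hq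
    have hq0 : 0 < q.toReal := by linarith
    rw [one_div q.toReal, ENNReal.le_rpow_inv_iff hq0]
    calc (2⁻¹ * X) ^ q.toReal = 2⁻¹ ^ q.toReal * X ^ q.toReal :=
          ENNReal.mul_rpow_of_nonneg _ _ hq0.le
      _ ≤ 2⁻¹ ^ (1 : ℝ) * X ^ q.toReal := by
          exact mul_le_mul_left (ENNReal.rpow_le_rpow_of_exponent_ge
            (ENNReal.inv_le_one.2 one_le_two) hq1) _
      _ = X ^ q.toReal / ENNReal.ofReal a * ENNReal.ofReal (a - a / 2) := by
          rw [ENNReal.rpow_one, sub_half, ha2, haD, mul_left_comm, ENNReal.div_mul_cancel hD hDt]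
      _ = ∫⁻ _ in Ioo (a / 2) a, X ^ q.toReal / ENNReal.ofReal a := by
          rw [setLIntegral_const, Real.volume_Ioo]
      _ ≤ ∫⁻ t in Ioo (a / 2) a, (ENNReal.ofReal t ^ (1 / p.toReal) *
            rearr μ f (ENNReal.ofReal t)) ^ q.toReal / ENNReal.ofReal t := by
          refine setLIntegral_mono' measurableSet_Ioo fun t ht => ?_
          exact ENNReal.div_le_div (ENNReal.rpow_le_rpow (hbound t ⟨ht.1.le, ht.2⟩) hq0.le)
            (ENNReal.ofReal_le_ofReal ht.2.le)
      _ ≤ _ := lintegral_mono_set fun t ht => lt_trans (by positivity) ht.1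

theorem distrib_eq_lintegral {α : Type*} [MeasurableSpace α] {μ : Measure α} {g : α → ℝ≥0∞}
    (hg : Measurable g) (v : ℝ≥0∞) :
    distrib μ (fun x => (g x : EReal)) v =
      ∫⁻ x, (Ioi v).indicator (1 : ℝ≥0∞ → ℝ≥0∞) (g x) ∂μ := by
  rw [distrib, ← one_mul (μ _), ← lintegral_indicator_const
    (by simpa using measurableSet_lt measurable_const hg)]
  refine lintegral_congr fun x => ?_
  simp [indicator]

/-- Otherwise a gliding hump has modular 1 while its weak `L^p` size at level t_k/2 is at least a
multiple of k + 1. Only inclusion of the sets is used, not boundedness of the embedding. -/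
theorem rpow_le_of_subset (hp : 1 ≤ p) (hpt : p ≠ ∞) (hq : 1 ≤ q) {A : ℝ≥0∞ → ℝ≥0∞}
    (hA : IsYoung A)
    (h : spaceOf (orliczNorm unitMeasure A) ⊆ spaceOf (lorentzNorm unitMeasure p q)) :
    ∃ c t₀ : ℝ≥0, 0 < c ∧ ∀ t : ℝ≥0, t₀ ≤ t → (t : ℝ≥0∞) ^ p.toReal ≤ c * A t := by
  have hp0 : 0 < p.toReal := ENNReal.toReal_pos (zero_lt_one.trans_le hp).ne' hpt
  by_contra! hcon
  obtain ⟨t, g, ht, hg, hAg, hgΨ⟩ := exists_measurable_lintegral_eq_one hA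
    (fun k t => 2 ^ (k + 2) * (k + 1 : ℝ≥0∞) ^ p.toReal * A t < (t : ℝ≥0∞) ^ p.toReal)
    (fun k t₀ => by
      obtain ⟨t, ht, hct⟩ := hcon (2 ^ (k + 2) * (k + 1) ^ p.toReal) t₀ (by positivity)
      rw [ENNReal.coe_mul, ENNReal.coe_rpow_of_nonneg _ hp0.le] at hct
      refine ⟨t, ht, fun htop => ?_, by simpa using hct⟩
      rw [htop, ENNReal.mul_top] at hct
      · exact absurd hct (by simp)
      · refine mul_ne_zero (by simp) ?_
        simp [hp0])
  have hfin := (h (mem_spaceOf_of_lintegral_eq_one hA hg hAg)).2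
  set N := lorentzNorm unitMeasure p q fun x => (g x : EReal)
  have hle : ∀ k : ℕ, 2⁻¹ * (2⁻¹ * (k + 1 : ℝ≥0∞)) ≤ N := fun k => by
    obtain ⟨hlt, hA0, hAt, ht0⟩ := ht k
    set v : ℝ≥0∞ := 2⁻¹ * t k with hv
    have hvt : v < t k := by
      rw [hv, mul_comm, ← div_eq_mul_inv]
      exact ENNReal.half_lt_self (by exact_mod_cast ht0.ne') (by simp)
    have hD : 2⁻¹ ^ (k + 1) * (A (t k))⁻¹ ≤ distrib unitMeasure (fun x => (g x : EReal)) v := by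
      have := hgΨ ((Ioi v).indicator 1) (indicator_of_notMem (by simp) _)
      rw [distrib_eq_lintegral hg, this]
      refine le_trans (le_of_eq ?_) (ENNReal.le_tsum k)
      rw [indicator_of_mem (by exact hvt), Pi.one_apply, one_mul]
    refine le_trans ?_ (le_lorentzNorm hp hpt hq _ v)
    refine mul_le_mul_right ?_ _
    calc 2⁻¹ * (k + 1 : ℝ≥0∞)
        ≤ 2⁻¹ * ((2⁻¹ * (2⁻¹ ^ (k + 1) * (A (t k))⁻¹)) * t k ^ p.toReal) ^ (1 / p.toReal) := by
          refine mul_le_mul_right ?_ _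
          rw [one_div, ENNReal.le_rpow_inv_iff hp0]
          calc (k + 1 : ℝ≥0∞) ^ p.toReal
              = 2⁻¹ * (2⁻¹ ^ (k + 1) * (A (t k))⁻¹) *
                (2 ^ (k + 2) * (k + 1 : ℝ≥0∞) ^ p.toReal * A (t k)) := by
                have h2 : (2⁻¹ : ℝ≥0∞) ^ (k + 2) * 2 ^ (k + 2) = 1 := by
                  rw [← mul_pow, ENNReal.inv_mul_cancel (by simp) (by simp), one_pow]
                calc _ = 1 * 1 * (k + 1 : ℝ≥0∞) ^ p.toReal := by ring
                  _ = (2⁻¹ ^ (k + 2) * 2 ^ (k + 2)) * (A (t k) * (A (t k))⁻¹) *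
                      (k + 1 : ℝ≥0∞) ^ p.toReal := by rw [h2, ENNReal.mul_inv_cancel hA0 hAt]
                  _ = _ := by ring
            _ ≤ _ := mul_le_mul_right hlt.le _
      _ = (2⁻¹ * (2⁻¹ ^ (k + 1) * (A (t k))⁻¹)) ^ (1 / p.toReal) * v := by
          rw [ENNReal.mul_rpow_of_nonneg _ _ (by positivity), ← ENNReal.rpow_mul,
            mul_one_div_cancel hp0.ne', ENNReal.rpow_one, mul_left_comm]
      _ ≤ _ := by gcongr
  obtain ⟨n, hn⟩ := ENNReal.exists_nat_gt (ENNReal.mul_ne_top (a := 4) (by simp) hfin.ne)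
  refine absurd hn (not_lt.2 ?_)
  calc (n : ℝ≥0∞) ≤ (n + 1) := le_self_add
    _ = 4 * (2⁻¹ * (2⁻¹ * (n + 1 : ℝ≥0∞))) := by
        rw [show (4 : ℝ≥0∞) = 2 * 2 by norm_num, ← mul_assoc, mul_assoc 2 2,
          ENNReal.mul_inv_cancel (by simp) (by simp), mul_one, ← mul_assoc,
          ENNReal.mul_inv_cancel (by simp) (by simp), one_mul]
    _ ≤ _ := mul_le_mul_right (hle n) _

theorem tsum_inv_two_pow_add (j : ℕ) : ∑' k : ℕ, (2⁻¹ : ℝ≥0∞) ^ (k + j + 1) = 2⁻¹ ^ j := by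
  simp_rw [show ∀ k, k + j + 1 = j + (k + 1) by intro k; ring, pow_add _ j]
  rw [ENNReal.tsum_mul_left, tsum_inv_two_pow_succ, mul_one]

theorem monotone_two_pow_div : Monotone fun k : ℕ => (2 : ℝ≥0∞) ^ k / (k + 1) := by
  refine monotone_nat_of_le_succ fun k => ?_
  rw [← ENNReal.mul_div_mul_right (2 ^ k) _ two_ne_zero ENNReal.ofNat_ne_top, ← pow_succ]
  refine ENNReal.div_le_div_left ?_ _
  rw [mul_two]
  push_cast
  exact add_le_add le_rfl le_add_self

/-- A function in `L^{p,q}`, `p < q`, outside `L^p`. -/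
theorem exists_lorentz_not_lebesgue (hp : 1 ≤ p) (hpt : p ≠ ∞) (hpq : p < q) :
    ∃ f ∈ spaceOf (lorentzNorm unitMeasure p q), ∫⁻ x, (f x).abs ^ p.toReal ∂unitMeasure = ∞ := by
  have hp0 : 0 < p.toReal := ENNReal.toReal_pos (zero_lt_one.trans_le hp).ne' hpt
  have hp1 : 0 < 1 / p.toReal := by positivity
  -- The borderline choice: t f^*(t)^p is at most 1/(j+1) on the j-th dyadic block, so the `L^p`
  -- integral is a harmonic series, whereas the `L^{p,q}` integral is bounded by ∑ (j+1)^{-q/p},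
  -- convergent because q > p.
  set y : ℕ → ℝ≥0∞ := fun k => 2 ^ k / (k + 1) with hy
  obtain ⟨g, hg, hgΨ⟩ := exists_measurable_forall_lintegral_eq_tsum
    (fun k => y k ^ (1 / p.toReal)) (m := fun _ => 1) (fun _ => le_rfl)
  simp only [mul_one] at hgΨ
  refine ⟨fun x => g x, ⟨hg.coe_ereal_ennreal, ?_⟩, ?_⟩
  swap
  · simp only [EReal.abs_coe_ennreal]
    rw [hgΨ (fun y => y ^ p.toReal) (by simp [hp0])]
    simp_rw [← ENNReal.rpow_mul, one_div_mul_cancel hp0.ne', ENNReal.rpow_one]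
    have : ∀ k : ℕ, y k * 2⁻¹ ^ (k + 1) = ((2⁻¹ * ((k : ℝ≥0) + 1)⁻¹ : ℝ≥0) : ℝ≥0∞) := fun k => by
      have h2 : (2 : ℝ≥0∞) ^ k * 2⁻¹ ^ k = 1 := by
        rw [← mul_pow, ENNReal.mul_inv_cancel (by simp) (by simp), one_pow]
      rw [ENNReal.coe_mul, ENNReal.coe_inv (by simp), ENNReal.coe_inv (by positivity)]
      calc y k * 2⁻¹ ^ (k + 1) = 2 ^ k * 2⁻¹ ^ k * (2⁻¹ * ((k : ℝ≥0∞) + 1)⁻¹) := by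
            rw [hy]; dsimp only; rw [div_eq_mul_inv]; ring
        _ = _ := by rw [h2, one_mul]; push_cast; rfl
    simp_rw [this]
    by_contra hc
    rw [← ne_eq, ENNReal.tsum_coe_ne_top_iff_summable, ← NNReal.summable_coe] at hc
    have h2 := (summable_mul_left_iff (a := (2⁻¹ : ℝ)) (by norm_num)).1 (by simpa using hc)
    have h3 := (summable_nat_add_iff (f := fun n : ℕ => (n : ℝ)⁻¹) 1).1 (by simpa using h2)
    exact Real.not_summable_natCast_inv h3
  have hrearr : ∀ (j : ℕ) (t : ℝ≥0∞), 2⁻¹ ^ (j + 1) ≤ t →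
      rearr unitMeasure (fun x => (g x : EReal)) t ≤ y j ^ (1 / p.toReal) := fun j t hjt => by
    refine sInf_le (le_trans ?_ hjt)
    set v := y j ^ (1 / p.toReal) with hv
    rw [distrib_eq_lintegral hg, hgΨ _ (indicator_of_notMem (by simp) _),
      ← ENNReal.summable.sum_add_tsum_nat_add' (k := j + 1), Finset.sum_eq_zero, zero_add,
      ← tsum_inv_two_pow_add]
    · refine ENNReal.tsum_le_tsum fun k => mul_le_of_le_one_left zero_le ?_
      exact indicator_le_self' (fun _ _ => zero_le) _
    · intro k hk
      rw [indicator_of_notMem, zero_mul]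
      rw [mem_Ioi, not_lt, hv]
      exact ENNReal.rpow_le_rpow (monotone_two_pow_div (Nat.lt_succ_iff.1 (Finset.mem_range.1 hk)))
        hp1.le
  have hJ : ∀ (j : ℕ), ∀ t ∈ Ioc ((2⁻¹ : ℝ) ^ (j + 1)) (2⁻¹ ^ j),
      ENNReal.ofReal t ^ (1 / p.toReal) *
        rearr unitMeasure (fun x => (g x : EReal)) (ENNReal.ofReal t) ≤
      ((j : ℝ≥0∞) + 1)⁻¹ ^ (1 / p.toReal) := fun j t ht => by
    have h1 : ∀ i : ℕ, ENNReal.ofReal (2⁻¹ ^ i) = 2⁻¹ ^ i := fun i => by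
      rw [ENNReal.ofReal_pow (by norm_num), ENNReal.ofReal_inv_of_pos (by norm_num)]; simp
    have h2 := ENNReal.ofReal_le_ofReal ht.1.le
    have h3 := ENNReal.ofReal_le_ofReal ht.2
    rw [h1] at h2 h3
    calc _ ≤ (2⁻¹ ^ j) ^ (1 / p.toReal) * y j ^ (1 / p.toReal) :=
          mul_le_mul' (ENNReal.rpow_le_rpow h3 hp1.le) (hrearr j _ h2)
      _ = _ := by
          rw [← ENNReal.mul_rpow_of_nonneg _ _ hp1.le, hy]
          dsimp only
          rw [← mul_div_assoc, ← mul_pow, ENNReal.inv_mul_cancel (by simp) (by simp), one_pow,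
            one_div]
  have hcover : ∀ t : ℝ, 0 < t → t < 1 → ∃ j : ℕ, t ∈ Ioc ((2⁻¹ : ℝ) ^ (j + 1)) (2⁻¹ ^ j) :=
    fun t h0 h1 => exists_nat_pow_near_of_lt_one h0 h1.le (by norm_num) (by norm_num)
  have hone : ∀ t : ℝ, 1 ≤ t →
      rearr unitMeasure (fun x => (g x : EReal)) (ENNReal.ofReal t) = 0 := fun t ht =>
    rearr_eq_zero (ENNReal.one_le_ofReal.2 ht)
  unfold lorentzNorm
  split_ifs with hqt
  · refine (iSup₂_le fun t ht => ?_).trans_lt ENNReal.one_lt_top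
    rcases lt_or_ge t 1 with h1 | h1
    · obtain ⟨j, hj⟩ := hcover t ht h1
      refine (hJ j t hj).trans (ENNReal.rpow_le_one (by simp) hp1.le)
    · simp [hone t h1]
  have hpq' : p.toReal < q.toReal := ENNReal.toReal_strict_mono hqt hpq
  have hq0 : 0 < q.toReal := by linarith
  refine ENNReal.rpow_lt_top_of_nonneg (by positivity) (ne_top_of_le_ne_top ?_
    (setLIntegral_mono' (g := fun t => ∑' j : ℕ, (Ioc ((2⁻¹ : ℝ) ^ (j + 1)) (2⁻¹ ^ j)).indicator
      (fun _ => (((j : ℝ≥0∞) + 1)⁻¹ ^ (1 / p.toReal)) ^ q.toReal /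
        ENNReal.ofReal (2⁻¹ ^ (j + 1))) t) measurableSet_Ioi fun t ht => ?_))
  · rw [lintegral_tsum fun j => (measurable_const.indicator measurableSet_Ioc).aemeasurable]
    have hterm : ∀ j : ℕ, ∫⁻ t in Ioi (0 : ℝ), (Ioc ((2⁻¹ : ℝ) ^ (j + 1)) (2⁻¹ ^ j)).indicator
        (fun _ => (((j : ℝ≥0∞) + 1)⁻¹ ^ (1 / p.toReal)) ^ q.toReal /
          ENNReal.ofReal (2⁻¹ ^ (j + 1))) t =
        ((((((j + 1 : ℕ) : ℝ≥0)) ^ (q.toReal / p.toReal))⁻¹ : ℝ≥0) : ℝ≥0∞) := fun j => by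
      have hpos : (0 : ℝ) < 2⁻¹ ^ (j + 1) := by positivity
      have hsub : Ioc ((2⁻¹ : ℝ) ^ (j + 1)) (2⁻¹ ^ j) ⊆ Ioi 0 := fun t ht => lt_trans hpos ht.1
      rw [lintegral_indicator_const measurableSet_Ioc, Measure.restrict_apply measurableSet_Ioc,
        inter_eq_left.2 hsub, Real.volume_Ioc,
        show (2⁻¹ : ℝ) ^ j - 2⁻¹ ^ (j + 1) = 2⁻¹ ^ (j + 1) by rw [pow_succ]; ring,
        ENNReal.div_mul_cancel (by simp) (by simp), ← ENNReal.rpow_mul,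
        one_div_mul_eq_div, ENNReal.inv_rpow, ENNReal.coe_inv (by positivity),
        ENNReal.coe_rpow_of_nonneg _ (by positivity)]
      simp
    simp_rw [hterm]
    rw [ENNReal.tsum_coe_ne_top_iff_summable]
    exact NNReal.summable_nat_add _
      (NNReal.summable_rpow_inv.2 ((one_lt_div hp0).2 hpq')) 1
  · rcases lt_or_ge t 1 with h1 | h1
    · obtain ⟨j, hj⟩ := hcover t ht h1
      refine le_trans ?_ (ENNReal.le_tsum j)
      rw [indicator_of_mem hj]
      exact ENNReal.div_le_div (ENNReal.rpow_le_rpow (hJ j t hj) hq0.le)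
        (ENNReal.ofReal_le_ofReal hj.1.le)
    · simp [hone t h1, hq0]

/-- The hypothesis is the common consequence of both forms of sub-diagonality, so one argument
serves both equivalences. -/
theorem le_of_exists_subset (hp : 1 ≤ p) (hpt : p ≠ ∞) (hq : 1 ≤ q)
    (h : ∀ f ∈ spaceOf (lorentzNorm unitMeasure p q), ∃ A, IsYoung A ∧
      f ∈ spaceOf (orliczNorm unitMeasure A) ∧
      spaceOf (orliczNorm unitMeasure A) ⊆ spaceOf (lorentzNorm unitMeasure p q)) : q ≤ p := by
  by_contra! hpq
  obtain ⟨f, hf, hftop⟩ := exists_lorentz_not_lebesgue hp hpt hpq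
  obtain ⟨A, hA, hfA, hsub⟩ := h f hf
  obtain ⟨c, t₀, hc, hct⟩ := rpow_le_of_subset hp hpt hq hA hsub
  obtain ⟨r, hr, -⟩ := ENNReal.lt_iff_exists_nnreal_btwn.1 hfA.2
  have hr0 : (r : ℝ≥0∞) ≠ 0 := (zero_le.trans_lt hr).ne'
  have hmod := orliczModular_le_one_of_lt hA hr
  have hp0 : 0 ≤ p.toReal := ENNReal.toReal_nonneg
  have hc0 : (c : ℝ≥0∞) ≠ 0 := by exact_mod_cast hc.ne'
  have hpt' : ∀ t : ℝ≥0∞, t ^ p.toReal ≤ (t₀ : ℝ≥0∞) ^ p.toReal + c * A t := fun t => by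
    rcases le_total t t₀ with ht | ht
    · exact (ENNReal.rpow_le_rpow ht hp0).trans le_self_add
    · refine le_add_left ?_
      induction t with
      | top => simp [hA.map_top, ENNReal.mul_top hc0]
      | coe t => exact hct t (by exact_mod_cast ht)
  refine absurd hftop (ne_top_of_le_ne_top ?_ (lintegral_mono (g := fun x =>
    (r : ℝ≥0∞) ^ p.toReal * ((t₀ : ℝ≥0∞) ^ p.toReal + c * A ((f x).abs / r))) fun x => ?_))
  · have hrt : (r : ℝ≥0∞) ^ p.toReal ≠ ∞ := ENNReal.rpow_ne_top_of_nonneg hp0 (by simp)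
    rw [lintegral_const_mul' _ _ hrt, lintegral_add_left measurable_const,
      lintegral_const_mul' _ _ (by simp)]
    refine ENNReal.mul_ne_top hrt (ENNReal.add_ne_top.2 ⟨?_, ENNReal.mul_ne_top (by simp)
      (ne_top_of_le_ne_top ENNReal.one_ne_top hmod)⟩)
    simp
  · calc (f x).abs ^ p.toReal = (r * ((f x).abs / r)) ^ p.toReal := by
          rw [ENNReal.mul_div_cancel hr0 (by simp)]
      _ ≤ _ := by
          rw [ENNReal.mul_rpow_of_nonneg _ _ hp0]
          exact mul_le_mul_right (hpt' _) _

end LorentzNecessity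

/-! ### The main theorem -/

theorem theoremT
    (E : ℝ≥0∞ → ℝ≥0∞) (hE : IsYoung E)
    (p q : ℝ≥0∞) (hp_one : 1 < p) (hp_top : p < ∞) (hq : 1 ≤ q)
    (w : ℝ → ℝ) (hw_anti : AntitoneOn w (Ioo 0 1)) (hw_pos : ∀ t ∈ Ioo (0 : ℝ) 1, 0 < w t)
    (hw_int : IntegrableOn w (Ioo 0 1)) :
    -- Lebesgue spaces
    (IsSubDiagonal unitMeasure (lebesgueNorm unitMeasure q) ∧
      (IsUniformlySubDiagonal unitMeasure (lebesgueNorm unitMeasure q) ↔ q < ∞)) ∧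
    -- Orlicz spaces
    (IsSubDiagonal unitMeasure (orliczNorm unitMeasure E) ∧
      (IsUniformlySubDiagonal unitMeasure (orliczNorm unitMeasure E) ↔
        IsFiniteValued E ∧ DeltaTwoNearInfinity E)) ∧
    -- Lorentz spaces
    ((IsSubDiagonal unitMeasure (lorentzNorm unitMeasure p q) ↔
        IsUniformlySubDiagonal unitMeasure (lorentzNorm unitMeasure p q)) ∧
      (IsUniformlySubDiagonal unitMeasure (lorentzNorm unitMeasure p q) ↔ q ≤ p)) ∧
    -- Lorentz endpoint spaces
    (IsSubDiagonal unitMeasure (lorentzEndpointNorm unitMeasure E) ∧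
      (IsFiniteValued E → NablaTwoNearInfinity E →
        IsUniformlySubDiagonal unitMeasure (lorentzEndpointNorm unitMeasure E))) ∧
    -- classical Lorentz spaces
    (q < ∞ →
      IsSubDiagonal unitMeasure (classicalLorentzNorm unitMeasure q.toReal w) ∧
      ((∃ c : ℝ, 0 < c ∧ ∀ t ∈ Ioo (0 : ℝ) 1, c * t ∈ Ioo (0 : ℝ) 1 → 2 * w (c * t) ≤ w t) →
        IsUniformlySubDiagonal unitMeasure
          (classicalLorentzNorm unitMeasure q.toReal w))) := by
  have hp : p ≠ ∞ := hp_top.ne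
  have hneg := le_of_exists_subset hp_one.le hp hq
  have hiff : IsUniformlySubDiagonal unitMeasure (lorentzNorm unitMeasure p q) ↔ q ≤ p :=
    ⟨fun h => hneg fun f hf => by
      obtain ⟨A, hA, -, hfA, hsub⟩ := h.exists_subset hf
      exact ⟨A, hA, hfA, hsub⟩,
    fun h => (isUniformlySubDiagonal_lorentzNorm hp_one.le hp hq h).2⟩
  have hiff' : IsSubDiagonal unitMeasure (lorentzNorm unitMeasure p q) ↔ q ≤ p :=
    ⟨fun h => hneg fun f hf => h.exists_subset hf,
    fun h => (isUniformlySubDiagonal_lorentzNorm hp_one.le hp hq h).1⟩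
  have hφ := isQuasiconcave_correlative hE
  refine ⟨⟨isSubDiagonal_lebesgueNorm hq, isUniformlySubDiagonal_lebesgueNorm_iff hq⟩,
    ⟨isSubDiagonal_orliczNorm hE, isUniformlySubDiagonal_orliczNorm_iff hE⟩,
    ⟨hiff'.trans hiff.symm, hiff⟩, ?_, fun hqt => ?_⟩
  · rw [lorentzEndpointNorm_eq_layerNorm]
    refine ⟨isSubDiagonal_layerNorm hφ le_rfl, fun hfin hnabla => ?_⟩
    obtain ⟨K, d, hK, hKt, hd, h⟩ := hnabla.exists_doubling hE hfin
    exact isUniformlySubDiagonal_layerNorm hφ le_rfl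
      (fun ε hε => exists_correlative_le hfin hε) hK hKt hd h
  · have hq1 : 1 ≤ q.toReal := by simpa using ENNReal.toReal_mono hqt.ne hq
    exact ⟨isSubDiagonal_classicalLorentzNorm hw_anti hw_pos hw_int hq1, fun ⟨c, hc, h⟩ =>
      isUniformlySubDiagonal_classicalLorentzNorm hw_anti hw_pos hw_int hq1 hc h⟩
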